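/- Let $N\ge 0$, let $\mathscr F:\mathbb R^N\to\mathbb R^N$ be globally Lipschitz, and let $\Phi(x,t)$ be its flow: $t\mapsto\Phi(x,t)$ is the unique global solution of $u'=\mathscr F(u)$, $u(0)=x$. Let $\mu$ be a Borel measure on $\mathbb R^N$, finite on compact sets and invariant under the flow, i.e. $\mu(\Phi(A,t))=\mu(A)$ for all Borel $A$ and all $t\in\mathbb R$. Let $\Omega\subset\mathbb R^N$ be open and $X=L^1(\Omega,d\mu)$ (real-valued functions). For $x\in\Omega$ put $\tau_\pm(x)=\inf\{s>0:\Phi(x,\pm s)\notin\Omega\}\in(0,\infty]$ ($\inf\varnothing=\infty$) and $I_x=(-\tau_-(x),\tau_+(x))$. Let $\Gamma_-=\{y\in\partial\Omega:\ y=\Phi(x,-\tau_-(x))\text{ for some }x\in\Omega\text{ with }\tau_-(x)<\infty\}$, and let $\mu_-$ be the Borel measure on $\Gamma_-$ given by $$\mu_-(A)=\lim_{\sigma\to0^+}\frac1\sigma\,\mu\{x\in\Omega:\ \tau_-(x)<\sigma,\ \Phi(x,-\tau_-(x))\in A\}.$$ *Test functions.* $\mathfrak Y$ is the set of bounded measurable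 $\psi:\Omega\to\mathbb R$ with compact support in $\Omega$ (the support being the complement in $\Omega$ of the largest open subset of $\Omega$ on which $\psi=0$ $\mu$-a.e.) such that for every $x\in\Omega$ the map $s\mapsto\psi(\Phi(x,s))$ is $C^1$ on $I_x$, and $x\mapsto D\psi(x):=\frac{d}{ds}\psi(\Phi(x,s))|_{s=0}$ is measurable and bounded on $\Omega$. *Maximal operator.* $f\in\mathscr D(T_{\max})$ with $T_{\max}f=g$ means $f,g\in X$ and $\int_\Omega g\,\psi\,d\mu=\int_\Omega f\,D\psi\,d\mu$ for all $\psi\in\mathfrak Y$. *Incoming trace.* For $f\in X$, a function $b$ on $\Gamma_-$ is an incoming trace of $f$, $\mathsf B^-f=b$, if there are $g\in X$ and a representative $f^\sharp$ of $f$ such that for $\mu$-a.e. $x\in\Omega$ and all $t_1\le t_2$ in $I_x$ the function $s\mapsto g(\Phi(x,s))$ is integrable on $[t_1,t_2]$ and $f^\sharp(\Phi(x,t_1))-f^\sharp(\Phi(x,t_2))=\int_{t_1}^{t_2}g(\Phi(x,s))\,ds$, and such that $\lim_{t\to0^+}f^\sharp(\Phi(y,t))=b(y)$ for $\mu_-$-a.e.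 $y\in\Gamma_-$. Then $T_{\max}$ is well defined (single-valued), and every $f\in\mathscr D(T_{\max})$ has an incoming trace $\mathsf B^-f$, which is unique up to $\mu_-$-null sets. Let $T_0$ be the restriction of $T_{\max}$ to $\mathscr D(T_0)=\{f\in\mathscr D(T_{\max}):\mathsf B^-f=0\}$. Then $T_0$ is the generator of a $C_0$-semigroup $(U_0(t))_{t\ge0}$ of nonnegative contractions on $X$, given for all $t\ge0$ and $f\in X$ by $$U_0(t)f(x)=f(\Phi(x,-t))\,\chi_{\{t<\tau_-(x)\}}(x)\qquad\text{for }\mu\text{-a.e. }x\in\Omega.$$ -/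

import Mathlib

open MeasureTheory Filter Topology Set
open scoped ENNReal NNReal

noncomputable section

namespace CharTransport

/-- The phase space `ℝ^N` with its Euclidean norm. -/
abbrev Phase (N : ℕ) : Type := EuclideanSpace ℝ (Fin N)

/-- `X` is a global solution of `X' = F(X)`, `X(0) = x`. -/
def IsCharacteristic {N : ℕ} (F : Phase N → Phase N) (x : Phase N) (X : ℝ → Phase N) : Prop :=
  X 0 = x ∧ ∀ s : ℝ, HasDerivAt X (F (X s)) s

open Classical in
/-- The flow `Φ(x,t)`: the value at time `t` of the global solution of `X' = F(X)`, `X(0) = x`.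
For a globally Lipschitz field this solution exists and is unique, so that the fallback value
is never used. -/
def flow {N : ℕ} (F : Phase N → Phase N) (x : Phase N) : ℝ → Phase N :=
  if h : ∃ X : ℝ → Phase N, IsCharacteristic F x X then h.choose else fun _ => x

/-- The measure `μ` is invariant under the flow: `μ (T_t A) = μ A`, where `T_t = Φ(·,t)`. -/
def FlowInvariant {N : ℕ} (F : Phase N → Phase N) (μ : Measure (Phase N)) : Prop :=
  ∀ (t : ℝ) (A : Set (Phase N)), MeasurableSet A → μ ((fun x => flow F x t) '' A) = μ A

/-- `τ₊(x) = inf {s > 0 | Φ(x,s) ∉ Ω}`, with `inf ∅ = ∞`. -/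
def tauPlus {N : ℕ} (F : Phase N → Phase N) (Ω : Set (Phase N)) (x : Phase N) : ℝ≥0∞ :=
  ⨅ (s : ℝ) (_ : 0 < s) (_ : flow F x s ∉ Ω), ENNReal.ofReal s

/-- `τ₋(x) = inf {s > 0 | Φ(x,-s) ∉ Ω}`, with `inf ∅ = ∞`. -/
def tauMinus {N : ℕ} (F : Phase N → Phase N) (Ω : Set (Phase N)) (x : Phase N) : ℝ≥0∞ :=
  ⨅ (s : ℝ) (_ : 0 < s) (_ : flow F x (-s) ∉ Ω), ENNReal.ofReal s

/-- The open interval `I_x = (-τ₋(x), τ₊(x))` (for `x ∈ Ω`, `Ω` open, both times are positive). -/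
def stayInterval {N : ℕ} (F : Phase N → Phase N) (Ω : Set (Phase N)) (x : Phase N) : Set ℝ :=
  {s | ENNReal.ofReal (-s) < tauMinus F Ω x ∧ ENNReal.ofReal s < tauPlus F Ω x}

/-- The point `Φ(x, -τ₋(x))` at which the characteristic through `x` has entered `Ω`
(meaningful when `τ₋(x) < ∞`). -/
def entryPoint {N : ℕ} (F : Phase N → Phase N) (Ω : Set (Phase N)) (x : Phase N) : Phase N :=
  flow F x (-(tauMinus F Ω x).toReal)

/-- The incoming part `Γ₋` of the boundary of `Ω`. -/
def incomingBoundary {N : ℕ} (F : Phase N → Phase N) (Ω : Set (Phase N)) : Set (Phase N) :=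
  {y | y ∈ frontier Ω ∧ ∃ x ∈ Ω, tauMinus F Ω x < ∞ ∧ y = entryPoint F Ω x}

/-- The boundary measure `μ₋` on `Γ₋`, as a Borel measure on `ℝ^N` carried by `Γ₋`:
`μ₋(A)` is the increasing limit, as `σ = 1/(n+1)` decreases to `0`, of
`σ⁻¹ μ {x ∈ Ω | τ₋(x) < σ, Φ(x,-τ₋(x)) ∈ A}`, that is, of
`σ⁻¹ μ {Φ(y,s) | y ∈ A ∩ Γ₋, 0 < s < min (σ, τ₊(y))}`.
When `τ₊ > δ > 0` on a bounded `A ⊆ Γ₋`, the quotient does not depend on `σ ≤ δ`; this is the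
measure for which `dμ = dμ₋ ⊗ ds` along the characteristics issued from `Γ₋`. -/
def incomingMeasure {N : ℕ} (F : Phase N → Phase N) (Ω : Set (Phase N)) (μ : Measure (Phase N)) :
    Measure (Phase N) :=
  ⨆ n : ℕ, ((n : ℝ≥0∞) + 1) •
    (μ.restrict {x | x ∈ Ω ∧ tauMinus F Ω x < ((n : ℝ≥0∞) + 1)⁻¹}).map (entryPoint F Ω)

/-- The derivative of `ψ` along the characteristics: `d/ds ψ(Φ(x,s))` at `s = 0`. -/
def charDeriv {N : ℕ} (F : Phase N → Phase N) (ψ : Phase N → ℝ) (x : Phase N) : ℝ :=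
  deriv (fun s : ℝ => ψ (flow F x s)) 0

/-- The class of test functions (only the values of `ψ` on `Ω` matter). As usual for measurable
functions, the support is the complement in `Ω` of the largest open subset of `Ω` on which `ψ`
vanishes `μ`-almost everywhere; it is compact if and only if `ψ` vanishes `μ`-almost everywhere
on `Ω \ K` for some compact `K ⊆ Ω`. -/
structure IsTestFunction {N : ℕ} (F : Phase N → Phase N) (Ω : Set (Phase N))
    (μ : Measure (Phase N)) (ψ : Phase N → ℝ) : Prop where
  measurable : Measurable (fun x : Ω => ψ x)
  bounded : ∃ C : ℝ, ∀ x ∈ Ω, |ψ x| ≤ C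
  compact_support : ∃ K : Set (Phase N), IsCompact K ∧ K ⊆ Ω ∧
    ∀ᵐ x ∂(μ.restrict Ω), x ∉ K → ψ x = 0
  contDiff_along : ∀ x ∈ Ω, ContDiffOn ℝ 1 (fun s : ℝ => ψ (flow F x s)) (stayInterval F Ω x)
  measurable_charDeriv : Measurable (fun x : Ω => charDeriv F ψ x)
  bounded_charDeriv : ∃ C : ℝ, ∀ x ∈ Ω, |charDeriv F ψ x| ≤ C

/-- The Banach space `X = L¹(Ω, dμ)` of real-valued functions. -/
abbrev L1Space {N : ℕ} (Ω : Set (Phase N)) (μ : Measure (Phase N)) : Type :=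
  Lp ℝ 1 (μ.restrict Ω)

/-- The graph of the maximal transport operator: `(f, g)` belongs to it when `f ∈ D(T_max)` and
`g = T_max f`, in the weak sense. -/
def maxTransport {N : ℕ} (F : Phase N → Phase N) (Ω : Set (Phase N)) (μ : Measure (Phase N)) :
    Set (L1Space Ω μ × L1Space Ω μ) :=
  {p | ∀ ψ : Phase N → ℝ, IsTestFunction F Ω μ ψ →
    ∫ x in Ω, p.2 x * ψ x ∂μ = ∫ x in Ω, p.1 x * charDeriv F ψ x ∂μ}

/-- `fs` is a representative of `f` such that, along `μ`-almost every characteristic in `Ω`,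
`fs(Φ(x,t₁)) - fs(Φ(x,t₂)) = ∫_{t₁}^{t₂} g(Φ(x,s)) ds`. -/
def IsMildRepresentative {N : ℕ} (F : Phase N → Phase N) (Ω : Set (Phase N))
    (μ : Measure (Phase N)) (f g : L1Space Ω μ) (fs : Phase N → ℝ) : Prop :=
  (f : Phase N → ℝ) =ᵐ[μ.restrict Ω] fs ∧
  ∀ᵐ x ∂(μ.restrict Ω), ∀ t₁ ∈ stayInterval F Ω x, ∀ t₂ ∈ stayInterval F Ω x, t₁ ≤ t₂ →
    IntervalIntegrable (fun s : ℝ => g (flow F x s)) volume t₁ t₂ ∧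
    fs (flow F x t₁) - fs (flow F x t₂) = ∫ s in t₁..t₂, g (flow F x s)

/-- `b` is the incoming trace `B⁻f`: for `μ₋`-almost every `y ∈ Γ₋`, `b(y)` is the limit of
`fs(Φ(y,t))` as `t → 0+`, where `fs` is a representative of `f` that is absolutely continuous
along almost every characteristic, with derivative in `L¹(Ω, dμ)`. -/
def IsIncomingTrace {N : ℕ} (F : Phase N → Phase N) (Ω : Set (Phase N)) (μ : Measure (Phase N))
    (f : L1Space Ω μ) (b : Phase N → ℝ) : Prop :=
  ∃ (g : L1Space Ω μ) (fs : Phase N → ℝ), IsMildRepresentative F Ω μ f g fs ∧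
    ∀ᵐ y ∂(incomingMeasure F Ω μ), y ∈ incomingBoundary F Ω →
      Tendsto (fun t : ℝ => fs (flow F y t)) (𝓝[>] 0) (𝓝 (b y))

/-- The graph of the transport operator `T₀`: the restriction of `T_max` to
`D(T₀) = {f ∈ D(T_max) | B⁻f = 0}`. -/
def zeroInflowTransport {N : ℕ} (F : Phase N → Phase N) (Ω : Set (Phase N))
    (μ : Measure (Phase N)) : Set (L1Space Ω μ × L1Space Ω μ) :=
  {p | p ∈ maxTransport F Ω μ ∧ IsIncomingTrace F Ω μ p.1 0}

/-- `C₀`-semigroups of bounded operators on a real normed space. -/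
structure IsC0Semigroup {E : Type*} [NormedAddCommGroup E] [NormedSpace ℝ E]
    (U : ℝ≥0 → E →L[ℝ] E) : Prop where
  map_zero : U 0 = ContinuousLinearMap.id ℝ E
  map_add : ∀ s t : ℝ≥0, U (s + t) = (U s).comp (U t)
  tendsto_zero : ∀ f : E, Tendsto (fun t : ℝ≥0 => U t f) (𝓝[>] 0) (𝓝 f)

/-- The graph of the generator of a semigroup `U`: all `(f, g)` with
`g = lim_{t → 0+} t⁻¹ (U(t)f - f)` in norm. -/
def generatorGraph {E : Type*} [NormedAddCommGroup E] [NormedSpace ℝ E]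
    (U : ℝ≥0 → E →L[ℝ] E) : Set (E × E) :=
  {p | Tendsto (fun t : ℝ≥0 => ((t : ℝ)⁻¹) • (U t p.1 - p.1)) (𝓝[>] 0) (𝓝 p.2)}

end CharTransport

end

open CharTransport

noncomputable section

namespace CharTransport

variable {N : ℕ} {F : Phase N → Phase N} {κ : ℝ≥0} {Ω : Set (Phase N)} {μ : Measure (Phase N)}

/-! Everything is reduced to one dimension by following characteristics. Invariance of `μ` makes
each `Φ(·,t)` measure preserving, so Fubini on `μ × dt` turns statements valid almost everywhere in
space into statements valid at almost all times along almost every characteristic.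

The weak equation is tested with `ψ(x) = ∫₀ᵗ φ(Φ(x,-s)) ds`, where `φ` is smooth with compact
support in the open set of points staying in `Ω` up to time `t`. Then `Dψ = φ - φ(Φ(·,-t))`, and
letting `φ` vary gives `f(Φ(x,t)) = f(x) - ∫₀ᵗ g(Φ(x,s)) ds` (`ae_sub_eq_integral_of_maxTransport`).
Averaging `f` forward along characteristics produces the continuous representative `charMean`, whose
limit at the entry point is `f(x) + ∫₀^τ g(Φ(x,-s)) ds` with `τ = τ₋(x)`. Null sets for `μ` on
characteristics and null sets for `μ₋` on `Γ₋` are matched by `ae_entryPoint_of_ae_incomingMeasure`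
and `ae_incomingMeasure_exists`; this yields existence and uniqueness of traces.

For a contraction semigroup, `(f, g)` lies in the generator exactly when `U(t)f - f = ∫₀ᵗ U(s)g ds`
for all `t`. For the transport semigroup this identity, read at `x`, is the integrated weak equation
while `t < τ₋(x)`, and for `t ≥ τ₋(x)` it says that the entry value of `f` is zero. Hence `T₀` is
contained in the generator. Conversely, pairing difference quotients with a test function and moving
the flow onto it shows that the generator is contained in `T_max`, and the identity at large times
forces zero trace. Single-valuedness of `T_max` then follows because `f = 0` has zero trace, so `(0,
g₁ - g₂)` belongs to the graph of a generator. -/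

/-! ### The flow of a globally Lipschitz field -/

/-- The Picard iterates of the integral equation `X(t) = x + ∫₀ᵗ F(X(s)) ds`. -/
def picardIterate (F : Phase N → Phase N) (x : Phase N) : ℕ → ℝ → Phase N
  | 0 => fun _ => x
  | k + 1 => fun t => x + ∫ s in (0 : ℝ)..t, F (picardIterate F x k s)

lemma continuous_picardIterate (hF : Continuous F) (x : Phase N) (k : ℕ) :
    Continuous (picardIterate F x k) := by
  induction k with
  | zero => exact continuous_const
  | succ k ih =>
    exact continuous_const.add (intervalIntegral.continuous_primitive
      (fun a b => (hF.comp ih).intervalIntegrable a b) 0)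

/-- The first increment is `t F(x)`; each further step costs a factor `κ` and one integration, which
builds up the factorial that makes the series converge on all of `ℝ`, with no smallness of `t`. -/
lemma norm_picardIterate_sub_le (hF : LipschitzWith κ F) (x : Phase N) (k : ℕ) (t : ℝ) :
    ‖picardIterate F x (k + 1) t - picardIterate F x k t‖
      ≤ ‖F x‖ * κ ^ k * |t| ^ (k + 1) / (k + 1).factorial := by
  induction k generalizing t with
  | zero => simp [picardIterate, norm_smul, mul_comm]
  | succ k ih =>
    have hc : ∀ j, Continuous fun s => F (picardIterate F x j s) := fun j =>
      hF.continuous.comp (continuous_picardIterate hF.continuous x j)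
    have h1 : picardIterate F x (k + 1 + 1) t - picardIterate F x (k + 1) t
        = ∫ s in (0 : ℝ)..t, (F (picardIterate F x (k + 1) s) - F (picardIterate F x k s)) := by
      rw [intervalIntegral.integral_sub ((hc (k + 1)).intervalIntegrable _ _)
        ((hc k).intervalIntegrable _ _)]
      simp only [picardIterate]
      abel
    have hb : ∀ s, ‖F (picardIterate F x (k + 1) s) - F (picardIterate F x k s)‖
        ≤ ‖F x‖ * κ ^ (k + 1) / (k + 1).factorial * |s| ^ (k + 1) := fun s => by
      calc _ ≤ κ * ‖picardIterate F x (k + 1) s - picardIterate F x k s‖ := hF.norm_sub_le _ _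
        _ ≤ κ * (‖F x‖ * κ ^ k * |s| ^ (k + 1) / (k + 1).factorial) := by gcongr; exact ih s
        _ = _ := by ring
    rw [h1]
    refine (intervalIntegral.norm_integral_le_abs_of_norm_le
      (Eventually.of_forall fun s => hb s)
      (by apply Continuous.intervalIntegrable; fun_prop)).trans (le_of_eq ?_)
    rw [intervalIntegral.integral_const_mul, abs_mul, abs_of_nonneg (by positivity)]
    have h2 : |∫ s in (0 : ℝ)..t, |s| ^ (k + 1)| = |t| ^ (k + 2) / (k + 2) := by
      rcases le_total 0 t with ht | ht
      · rw [intervalIntegral.integral_congr (g := fun s => s ^ (k + 1)), integral_pow]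
        · rw [abs_of_nonneg ht, zero_pow (by positivity), sub_zero, abs_of_nonneg (by positivity)]
          push_cast; ring
        · intro s hs
          rw [uIcc_of_le ht] at hs
          simp [abs_of_nonneg hs.1]
      · rw [intervalIntegral.integral_congr (g := fun s => (-s) ^ (k + 1)),
          intervalIntegral.integral_comp_neg (fun s => s ^ (k + 1)), integral_pow]
        · rw [abs_of_nonpos ht, abs_of_nonpos]
          · push_cast; ring
          · have : 0 ≤ (-t) ^ (k + 1 + 1) := pow_nonneg (by linarith) _
            apply div_nonpos_of_nonpos_of_nonneg
            · simp only [neg_zero]; rw [zero_pow (by positivity)]; linarith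
            · positivity
        · intro s hs
          rw [uIcc_of_ge ht] at hs
          simp [abs_of_nonpos hs.2]
    rw [h2, Nat.factorial_succ (k + 1)]
    push_cast
    field_simp
    ring

/-- Global existence for a globally Lipschitz field. -/
lemma exists_isCharacteristic (hF : LipschitzWith κ F) (x : Phase N) :
    ∃ X : ℝ → Phase N, IsCharacteristic F x X := by
  set Y := picardIterate F x
  have hYc : ∀ k, Continuous (Y k) := continuous_picardIterate hF.continuous x
  set u : ℝ → ℕ → ℝ := fun T k => ‖F x‖ * T * ((κ * T) ^ k / k.factorial)
  have hu : ∀ T, Summable (u T) := fun T => (Real.summable_pow_div_factorial _).mul_left _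
  -- The factorial `(k+1)!` is weakened to `k!`, so that `u T` is a multiple of the exponential
  -- series at `κT` and bounds the increments uniformly on `|t| ≤ T`.
  have hle : ∀ T t : ℝ, |t| ≤ T → ∀ k, ‖Y (k + 1) t - Y k t‖ ≤ u T k := fun T t ht k => by
    have hT : 0 ≤ T := (abs_nonneg t).trans ht
    calc _ ≤ ‖F x‖ * κ ^ k * |t| ^ (k + 1) / (k + 1).factorial :=
          norm_picardIterate_sub_le hF x k t
      _ ≤ ‖F x‖ * κ ^ k * T ^ (k + 1) / k.factorial := by
          gcongr; exact Nat.le_succ k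
      _ = u T k := by simp only [u, mul_pow]; ring
  have hY0 : ∀ t, Y 0 t = x := fun t => rfl
  have hsum : ∀ n t, ∑ k ∈ Finset.range n, (Y (k + 1) t - Y k t) = Y n t - x := fun n t => by
    rw [Finset.sum_range_sub (fun k => Y k t), hY0]
  set X : ℝ → Phase N := fun t => x + ∑' k, (Y (k + 1) t - Y k t)
  have hlim : ∀ t, Tendsto (fun n => Y n t) atTop (𝓝 (X t)) := fun t => by
    have hs : Summable fun k => Y (k + 1) t - Y k t :=
      Summable.of_norm_bounded (hu |t|) (hle |t| t le_rfl)
    have := (hs.hasSum.tendsto_sum_nat).const_add x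
    refine this.congr fun n => ?_
    rw [hsum]; abel
  have hXc : Continuous X := by
    rw [continuous_iff_continuousAt]
    intro t
    have : ContinuousOn X (Metric.ball 0 (|t| + 1)) := by
      refine continuousOn_const.add (continuousOn_tsum (u := u (|t| + 1))
        (fun k => ((hYc (k + 1)).sub (hYc k)).continuousOn) (hu _) fun k s hs => ?_)
      refine hle _ s ?_ k
      rw [mem_ball_zero_iff, Real.norm_eq_abs] at hs
      exact hs.le
    exact this.continuousAt (Metric.isOpen_ball.mem_nhds (by simp))
  have hint : ∀ t, X t = x + ∫ s in (0 : ℝ)..t, F (X s) := fun t => by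
    refine tendsto_nhds_unique ((tendsto_add_atTop_iff_nat 1).2 (hlim t)) ?_
    refine Tendsto.const_add x ?_
    refine intervalIntegral.tendsto_integral_filter_of_dominated_convergence
      (fun _ => ‖F x‖ + κ * ∑' k, u |t| k) (Eventually.of_forall fun n =>
        (hF.continuous.comp (hYc n)).aestronglyMeasurable) ?_ intervalIntegrable_const
      (Eventually.of_forall fun s _ => (hF.continuous.tendsto _).comp (hlim s))
    refine Eventually.of_forall fun n => Eventually.of_forall fun s hs => ?_
    have hs' : |s| ≤ |t| := by
      rcases le_total 0 t with ht | ht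
      · rw [uIoc_of_le ht] at hs
        rw [abs_of_nonneg ht, abs_of_nonneg hs.1.le]; exact hs.2
      · rw [uIoc_of_ge ht] at hs
        rw [abs_of_nonpos ht, abs_of_nonpos hs.2]; linarith [hs.1]
    have hn : ‖Y n s - x‖ ≤ ∑' k, u |t| k := by
      rw [← hsum]
      refine (norm_sum_le _ _).trans ((Finset.sum_le_sum fun k _ => hle _ s hs' k).trans ?_)
      exact (hu _).sum_le_tsum _ fun k _ => by positivity
    calc ‖F (Y n s)‖ = ‖F x + (F (Y n s) - F x)‖ := by congr 1; abel
      _ ≤ ‖F x‖ + ‖F (Y n s) - F x‖ := norm_add_le _ _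
      _ ≤ ‖F x‖ + κ * ‖Y n s - x‖ := by gcongr; exact hF.norm_sub_le _ _
      _ ≤ _ := by gcongr
  refine ⟨X, by rw [hint 0]; simp, fun t => ?_⟩
  have h := ((hF.continuous.comp hXc).integral_hasStrictDerivAt 0 t).hasDerivAt.const_add x
  exact h.congr_of_eventuallyEq (Eventually.of_forall hint)

lemma isCharacteristic_flow (hF : LipschitzWith κ F) (x : Phase N) :
    IsCharacteristic F x (flow F x) := by
  have h := exists_isCharacteristic hF x
  rw [flow, dif_pos h]
  exact h.choose_spec

lemma flow_zero (hF : LipschitzWith κ F) (x : Phase N) : flow F x 0 = x :=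
  (isCharacteristic_flow hF x).1

lemma hasDerivAt_flow (hF : LipschitzWith κ F) (x : Phase N) (s : ℝ) :
    HasDerivAt (flow F x) (F (flow F x s)) s :=
  (isCharacteristic_flow hF x).2 s

lemma flow_flow (hF : LipschitzWith κ F) (x : Phase N) (s t : ℝ) :
    flow F (flow F x s) t = flow F x (s + t) := by
  have h : flow F (flow F x s) = fun t => flow F x (s + t) := by
    refine ODE_solution_unique_univ (v := fun _ => F) (s := fun _ => univ) (K := κ) (t₀ := 0)
      (fun _ => hF.lipschitzOnWith)
      (fun t => ⟨hasDerivAt_flow hF _ t, mem_univ _⟩) (fun t => ⟨?_, mem_univ _⟩) ?_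
    · simpa using (hasDerivAt_flow hF x (s + t)).comp_const_add s t
    · simp [flow_zero hF]
  exact congrFun h t

lemma flow_neg_flow (hF : LipschitzWith κ F) (x : Phase N) (s : ℝ) :
    flow F (flow F x s) (-s) = x := by
  rw [flow_flow hF, add_neg_cancel, flow_zero hF]

lemma flow_flow_neg (hF : LipschitzWith κ F) (x : Phase N) (s : ℝ) :
    flow F (flow F x (-s)) s = x := by
  rw [flow_flow hF, neg_add_cancel, flow_zero hF]

lemma continuous_flow_right (hF : LipschitzWith κ F) (x : Phase N) : Continuous (flow F x) :=
  continuous_iff_continuousAt.2 fun s => (hasDerivAt_flow hF x s).continuousAt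

/-- Grönwall's inequality forward in time; negative times are handled by running the field `-F`,
which has the same Lipschitz constant. This is why `key` is stated for an arbitrary field `G`. -/
lemma dist_flow_le (hF : LipschitzWith κ F) (x y : Phase N) (t : ℝ) :
    dist (flow F x t) (flow F y t) ≤ dist x y * Real.exp (κ * |t|) := by
  have key : ∀ (G : Phase N → Phase N) (_ : LipschitzWith κ G) (X Y : ℝ → Phase N)
      (_ : ∀ s, HasDerivAt X (G (X s)) s) (_ : ∀ s, HasDerivAt Y (G (Y s)) s) (r : ℝ), 0 ≤ r →
      dist (X r) (Y r) ≤ dist (X 0) (Y 0) * Real.exp (κ * r) := by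
    intro G hG X Y hX hY r hr
    have := dist_le_of_trajectories_ODE (v := fun _ => G) (K := κ) (f := X) (g := Y) (a := 0)
      (b := r) (δ := dist (X 0) (Y 0)) (fun _ => hG)
      (fun s _ => (hX s).continuousAt.continuousWithinAt) (fun s _ => (hX s).hasDerivWithinAt)
      (fun s _ => (hY s).continuousAt.continuousWithinAt) (fun s _ => (hY s).hasDerivWithinAt)
      le_rfl r (right_mem_Icc.2 hr)
    simpa using this
  rcases le_total 0 t with ht | ht
  · have := key F hF _ _ (hasDerivAt_flow hF x) (hasDerivAt_flow hF y) t ht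
    rwa [flow_zero hF, flow_zero hF, show κ * t = κ * |t| by rw [abs_of_nonneg ht]] at this
  · have hd : ∀ z s, HasDerivAt (fun r => flow F z (-r)) (-F (flow F z (-s))) s := fun z s => by
      have h := (hasDerivAt_flow hF z (-s)).scomp s (hasDerivAt_neg s)
      rw [neg_one_smul] at h
      exact h
    have := key (fun z => -F z) hF.neg _ _ (hd x) (hd y) (-t) (by linarith)
    simpa [flow_zero hF, abs_of_nonpos ht] using this

lemma continuous_flow (hF : LipschitzWith κ F) :
    Continuous fun p : Phase N × ℝ => flow F p.1 p.2 := by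
  rw [continuous_iff_continuousAt]
  rintro ⟨x, t⟩
  rw [ContinuousAt, tendsto_iff_dist_tendsto_zero]
  have h : Tendsto (fun p : Phase N × ℝ => dist p.1 x * Real.exp (κ * |p.2|)
      + dist (flow F x p.2) (flow F x t)) (𝓝 (x, t)) (𝓝 0) := by
    have : Continuous fun p : Phase N × ℝ => dist p.1 x * Real.exp (κ * |p.2|)
      + dist (flow F x p.2) (flow F x t) := by
      have := (continuous_flow_right hF x).comp (continuous_snd (X := Phase N) (Y := ℝ))
      have h' : Continuous fun p : Phase N × ℝ => flow F x p.2 := this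
      fun_prop
    simpa using this.tendsto (x, t)
  refine squeeze_zero (fun _ => dist_nonneg) (fun p => ?_) h
  exact (dist_triangle _ (flow F x p.2) _).trans (by gcongr; exact dist_flow_le hF _ _ _)

lemma continuous_flow_left (hF : LipschitzWith κ F) (t : ℝ) : Continuous fun x => flow F x t :=
  (continuous_flow hF).comp (continuous_id.prodMk continuous_const)

lemma measurable_flow (hF : LipschitzWith κ F) :
    Measurable fun p : Phase N × ℝ => flow F p.1 p.2 :=
  (continuous_flow hF).measurable

/-- The preimage of a set under `Φ(·,t)` is its image under `Φ(·,-t)`, so invariance of images is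
used at time `-t`. -/
lemma measurePreserving_flow (hF : LipschitzWith κ F) {μ : Measure (Phase N)}
    (hμ : FlowInvariant F μ) (t : ℝ) : MeasurePreserving (fun x => flow F x t) μ μ := by
  refine ⟨(continuous_flow_left hF t).measurable, Measure.ext fun A hA => ?_⟩
  rw [Measure.map_apply (continuous_flow_left hF t).measurable hA, ← hμ (-t) A hA]
  congr 1
  ext x
  simp only [mem_preimage, mem_image]
  exact ⟨fun h => ⟨_, h, flow_neg_flow hF x t⟩,
    fun ⟨y, hy, hyx⟩ => by rwa [← hyx, flow_flow_neg hF]⟩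

/-! ### Characteristics staying in `Ω` -/

/-- The pairs `(x, t)` such that the characteristic through `x` stays in `Ω` between the times
`0` and `t`. -/
def stayDomain (F : Phase N → Phase N) (Ω : Set (Phase N)) : Set (Phase N × ℝ) :=
  {p | ∀ θ ∈ Icc (0 : ℝ) 1, flow F p.1 (θ * p.2) ∈ Ω}

lemma isOpen_stayDomain (hF : LipschitzWith κ F) (hΩ : IsOpen Ω) : IsOpen (stayDomain F Ω) := by
  rw [isOpen_iff_eventually]
  intro p hp
  -- Rescaling the time segment to the fixed compact interval `[0,1]` makes this the tube lemma, and
  -- treats both signs of `t` at once.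
  refine isCompact_Icc.eventually_forall_of_forall_eventually fun θ hθ => ?_
  have hc : Continuous fun z : (Phase N × ℝ) × ℝ => flow F z.1.1 (z.2 * z.1.2) :=
    (continuous_flow hF).comp (by fun_prop : Continuous fun z : (Phase N × ℝ) × ℝ =>
      (z.1.1, z.2 * z.1.2))
  exact hc.continuousAt.eventually_mem (hΩ.mem_nhds (hp θ hθ))

lemma mem_stayDomain_of_nonneg {x : Phase N} {t : ℝ} (ht : 0 ≤ t) :
    (x, t) ∈ stayDomain F Ω ↔ ∀ s ∈ Icc 0 t, flow F x s ∈ Ω := by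
  refine ⟨fun h s hs => ?_, fun h θ hθ => h _ ⟨mul_nonneg hθ.1 ht, ?_⟩⟩
  · rcases ht.eq_or_lt with rfl | ht'
    · have : s = 0 := le_antisymm hs.2 hs.1
      simpa [this] using h 0 (by simp)
    · have := h (s / t) ⟨div_nonneg hs.1 ht, (div_le_one ht').2 hs.2⟩
      rwa [div_mul_cancel₀ _ ht'.ne'] at this
  · exact mul_le_of_le_one_left ht hθ.2

lemma mem_stayDomain_neg {x : Phase N} {t : ℝ} (ht : 0 ≤ t) :
    (x, -t) ∈ stayDomain F Ω ↔ ∀ s ∈ Icc 0 t, flow F x (-s) ∈ Ω := by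
  refine ⟨fun h s hs => ?_, fun h θ hθ => ?_⟩
  · rcases ht.eq_or_lt with rfl | ht'
    · have : s = 0 := le_antisymm hs.2 hs.1
      simpa [this] using h 0 (by simp)
    · have := h (s / t) ⟨div_nonneg hs.1 ht, (div_le_one ht').2 hs.2⟩
      rwa [mul_neg, div_mul_cancel₀ _ ht'.ne'] at this
  · have := h _ ⟨mul_nonneg hθ.1 ht, mul_le_of_le_one_left ht hθ.2⟩
    rwa [← mul_neg] at this

lemma mem_stayDomain_iff {x : Phase N} {t : ℝ} :
    (x, t) ∈ stayDomain F Ω ↔ ∀ s ∈ uIcc 0 t, flow F x s ∈ Ω := by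
  rcases le_total 0 t with ht | ht
  · rw [uIcc_of_le ht, mem_stayDomain_of_nonneg ht]
  · obtain ⟨t, rfl⟩ : ∃ r, t = -r := ⟨-t, by simp⟩
    rw [uIcc_of_ge ht, mem_stayDomain_neg (by linarith)]
    exact ⟨fun h s hs => by simpa using h (-s) ⟨by linarith [hs.2], by linarith [hs.1]⟩,
      fun h s hs => h (-s) ⟨by linarith [hs.2], by linarith [hs.1]⟩⟩

lemma flow_mem_of_mem_stayDomain {x : Phase N} {t : ℝ} (h : (x, t) ∈ stayDomain F Ω) :
    flow F x t ∈ Ω :=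
  mem_stayDomain_iff.1 h t right_mem_uIcc

lemma mem_of_mem_stayDomain (hF : LipschitzWith κ F) {x : Phase N} {t : ℝ}
    (h : (x, t) ∈ stayDomain F Ω) : x ∈ Ω := by
  simpa [flow_zero hF] using mem_stayDomain_iff.1 h 0 left_mem_uIcc

lemma mem_stayDomain_zero (hF : LipschitzWith κ F) {x : Phase N} :
    (x, (0 : ℝ)) ∈ stayDomain F Ω ↔ x ∈ Ω := by
  simp [mem_stayDomain_iff, flow_zero hF]

lemma stayDomain_mono {x : Phase N} {s t : ℝ} (h : (x, t) ∈ stayDomain F Ω)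
    (hs : s ∈ uIcc 0 t) : (x, s) ∈ stayDomain F Ω :=
  mem_stayDomain_iff.2 fun r hr => mem_stayDomain_iff.1 h r (uIcc_subset_uIcc_left hs hr)

lemma mem_stayDomain_of_uIcc {x : Phase N} {s t r : ℝ} (hs : (x, s) ∈ stayDomain F Ω)
    (ht : (x, t) ∈ stayDomain F Ω) (hr : r ∈ uIcc s t) : (x, r) ∈ stayDomain F Ω := by
  rcases (uIcc_subset_uIcc_union_uIcc (b := (0 : ℝ)) : uIcc s t ⊆ _) hr with h | h
  · exact stayDomain_mono hs (by rwa [uIcc_comm])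
  · exact stayDomain_mono ht h

/-- The characteristic through `Φ(x,s)` stays in `Ω` up to time `t` exactly when the one through
`x` does between `s` and `s + t`, for `(x, s)` in the stay domain. -/
lemma flow_mem_stayDomain_iff (hF : LipschitzWith κ F) {x : Phase N} {s t : ℝ}
    (hs : (x, s) ∈ stayDomain F Ω) :
    (flow F x s, t) ∈ stayDomain F Ω ↔ (x, s + t) ∈ stayDomain F Ω := by
  simp only [mem_stayDomain_iff, flow_flow hF] at hs ⊢
  constructor
  · intro h r hr
    rcases (uIcc_subset_uIcc_union_uIcc (b := s) : uIcc 0 (s + t) ⊆ _) hr with h' | h'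
    · exact hs r h'
    · have := h (r - s) (by
        rw [mem_uIcc] at h' ⊢
        rcases h' with h' | h'
        · left; constructor <;> linarith
        · right; constructor <;> linarith)
      simpa using this
  · intro h r hr
    have : s + r ∈ uIcc s (s + t) := by
      rw [mem_uIcc] at hr ⊢
      rcases hr with h' | h'
      · left; constructor <;> linarith
      · right; constructor <;> linarith
    rcases (uIcc_subset_uIcc_union_uIcc (b := (0 : ℝ)) : uIcc s (s + t) ⊆ _) this with h' | h'
    · exact hs _ (by rwa [uIcc_comm])
    · exact h _ h'

/-- The stay domain is symmetric under running the characteristic backwards. -/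
lemma stayDomain_flow_symm (hF : LipschitzWith κ F) {x : Phase N} {t : ℝ} :
    (flow F x t, -t) ∈ stayDomain F Ω ↔ (x, t) ∈ stayDomain F Ω := by
  have key : ∀ {x : Phase N} {t : ℝ}, (x, t) ∈ stayDomain F Ω →
      (flow F x t, -t) ∈ stayDomain F Ω := fun {x t} h => by
    rw [flow_mem_stayDomain_iff hF h, add_neg_cancel, mem_stayDomain_zero hF]
    exact mem_of_mem_stayDomain hF h
  refine ⟨fun h => ?_, key⟩
  have := key h
  rwa [flow_neg_flow hF, neg_neg] at this

/-! ### Exit times, entry times and entry points -/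

lemma flow_neg_field (hF : LipschitzWith κ F) (x : Phase N) (s : ℝ) :
    flow (fun z => -F z) x s = flow F x (-s) := by
  have hF' : LipschitzWith κ fun z => -F z := hF.neg
  have h : flow (fun z => -F z) x = fun s => flow F x (-s) := by
    refine ODE_solution_unique_univ (v := fun _ z => -F z) (s := fun _ => univ) (K := κ)
      (t₀ := 0) (fun _ => hF'.lipschitzOnWith)
      (fun t => ⟨hasDerivAt_flow hF' _ t, mem_univ _⟩) (fun t => ⟨?_, mem_univ _⟩) ?_
    · have h := (hasDerivAt_flow hF x (-t)).scomp t (hasDerivAt_neg t)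
      rw [neg_one_smul] at h
      exact h
    · simp [flow_zero hF, flow_zero hF']
  exact congrFun h s

/-- The strict inequality corresponds to staying on the closed segment `[0,t]`: since `Ω` is open, a
characteristic that is still inside at time `t` remains inside a little longer. Through this
equivalence and its backward counterpart, the exit times are handled by means of an open set. -/
lemma ofReal_lt_tauPlus_iff (hF : LipschitzWith κ F) (hΩ : IsOpen Ω) {x : Phase N} (hx : x ∈ Ω)
    {t : ℝ} (ht : 0 ≤ t) :
    ENNReal.ofReal t < tauPlus F Ω x ↔ (x, t) ∈ stayDomain F Ω := by
  constructor
  · intro h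
    rw [mem_stayDomain_of_nonneg ht]
    intro s hs
    rcases hs.1.eq_or_lt with rfl | hs0
    · rwa [flow_zero hF]
    · by_contra hc
      exact absurd (h.trans_le ((iInf_le_of_le s (iInf_le_of_le hs0 (iInf_le _ hc))).trans
        (ENNReal.ofReal_le_ofReal hs.2))) (lt_irrefl _)
  · intro h
    have hopen : IsOpen {s : ℝ | (x, s) ∈ stayDomain F Ω} :=
      (isOpen_stayDomain hF hΩ).preimage (by fun_prop : Continuous fun s : ℝ => (x, s))
    obtain ⟨ε, hε, hb⟩ := Metric.isOpen_iff.1 hopen t h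
    have h' : (x, t + ε / 2) ∈ stayDomain F Ω := hb (by
      rw [Metric.mem_ball, Real.dist_eq, add_sub_cancel_left, abs_of_pos] <;> linarith)
    refine ((ENNReal.ofReal_lt_ofReal_iff (by linarith)).2
      (by linarith : t < t + ε / 2)).trans_le ?_
    refine le_iInf fun s => le_iInf fun hs => le_iInf fun hsΩ => ENNReal.ofReal_le_ofReal ?_
    by_contra hc
    exact hsΩ ((mem_stayDomain_of_nonneg (by linarith)).1 h' s ⟨hs.le, (not_le.1 hc).le⟩)

lemma tauPlus_neg_field (hF : LipschitzWith κ F) (x : Phase N) :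
    tauPlus (fun z => -F z) Ω x = tauMinus F Ω x := by
  simp only [tauPlus, tauMinus, flow_neg_field hF]

lemma ofReal_lt_tauMinus_iff (hF : LipschitzWith κ F) (hΩ : IsOpen Ω) {x : Phase N} (hx : x ∈ Ω)
    {t : ℝ} (ht : 0 ≤ t) :
    ENNReal.ofReal t < tauMinus F Ω x ↔ (x, -t) ∈ stayDomain F Ω := by
  have hF' : LipschitzWith κ fun z => -F z := hF.neg
  rw [← tauPlus_neg_field hF, ofReal_lt_tauPlus_iff hF' hΩ hx ht, mem_stayDomain_of_nonneg ht,
    mem_stayDomain_neg ht]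
  simp only [flow_neg_field hF]

lemma tauPlus_pos (hF : LipschitzWith κ F) (hΩ : IsOpen Ω) {x : Phase N} (hx : x ∈ Ω) :
    0 < tauPlus F Ω x := by
  simpa using (ofReal_lt_tauPlus_iff hF hΩ hx le_rfl).2 ((mem_stayDomain_zero hF).2 hx)

lemma tauMinus_pos (hF : LipschitzWith κ F) (hΩ : IsOpen Ω) {x : Phase N} (hx : x ∈ Ω) :
    0 < tauMinus F Ω x := by
  simpa using (ofReal_lt_tauMinus_iff hF hΩ hx le_rfl).2 (by
    simpa using (mem_stayDomain_zero hF).2 hx)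

lemma mem_stayInterval_iff (hF : LipschitzWith κ F) (hΩ : IsOpen Ω) {x : Phase N} (hx : x ∈ Ω)
    {t : ℝ} : t ∈ stayInterval F Ω x ↔ (x, t) ∈ stayDomain F Ω := by
  rcases le_total 0 t with ht | ht
  · rw [← ofReal_lt_tauPlus_iff hF hΩ hx ht, stayInterval, mem_ofPred_eq,
      ENNReal.ofReal_of_nonpos (by linarith : -t ≤ 0)]
    exact and_iff_right (tauMinus_pos hF hΩ hx)
  · have h := ofReal_lt_tauMinus_iff hF hΩ hx (by linarith : 0 ≤ -t)
    rw [neg_neg] at h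
    rw [← h, stayInterval, mem_ofPred_eq, ENNReal.ofReal_of_nonpos ht]
    exact and_iff_left (tauPlus_pos hF hΩ hx)

lemma lt_tauMinus_toReal_iff (hF : LipschitzWith κ F) (hΩ : IsOpen Ω) {x : Phase N} (hx : x ∈ Ω)
    (hτ : tauMinus F Ω x < ∞) {t : ℝ} (ht : 0 ≤ t) :
    t < (tauMinus F Ω x).toReal ↔ (x, -t) ∈ stayDomain F Ω := by
  rw [← ofReal_lt_tauMinus_iff hF hΩ hx ht, ENNReal.ofReal_lt_iff_lt_toReal ht hτ.ne]

lemma tauMinus_toReal_pos (hF : LipschitzWith κ F) (hΩ : IsOpen Ω) {x : Phase N} (hx : x ∈ Ω)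
    (hτ : tauMinus F Ω x < ∞) : 0 < (tauMinus F Ω x).toReal :=
  ENNReal.toReal_pos (tauMinus_pos hF hΩ hx).ne' hτ.ne

/-- Moving back along a characteristic by `t < τ₋` decreases `τ₋` by `t`. -/
lemma tauMinus_flow_neg (hF : LipschitzWith κ F) (hΩ : IsOpen Ω) {x : Phase N}
    {t : ℝ} (ht : 0 ≤ t) (h : (x, -t) ∈ stayDomain F Ω) :
    tauMinus F Ω (flow F x (-t)) = tauMinus F Ω x - ENNReal.ofReal t := by
  have hx := mem_of_mem_stayDomain hF h
  -- Both sides may be infinite; comparing the finite times strictly below them reduces the claim to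
  -- concatenation of stay segments.
  refine eq_of_forall_lt_iff fun c => ?_
  by_cases hc : c = ∞
  · simp [hc]
  obtain ⟨c, rfl⟩ : ∃ r : ℝ≥0, c = r := ⟨c.toNNReal, (ENNReal.coe_toNNReal hc).symm⟩
  rw [← ENNReal.ofReal_coe_nnreal, ofReal_lt_tauMinus_iff hF hΩ (flow_mem_of_mem_stayDomain h)
    c.coe_nonneg, flow_mem_stayDomain_iff hF h, lt_tsub_iff_right,
    ← ENNReal.ofReal_add c.coe_nonneg ht, ofReal_lt_tauMinus_iff hF hΩ hx (add_nonneg c.coe_nonneg ht)]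
  rw [neg_add_rev]

lemma entryPoint_flow_neg (hF : LipschitzWith κ F) (hΩ : IsOpen Ω) {x : Phase N}
    (hτ : tauMinus F Ω x < ∞) {t : ℝ} (ht : 0 ≤ t) (h : (x, -t) ∈ stayDomain F Ω) :
    entryPoint F Ω (flow F x (-t)) = entryPoint F Ω x := by
  have hx := mem_of_mem_stayDomain hF h
  have hlt := (ofReal_lt_tauMinus_iff hF hΩ hx ht).2 h
  rw [entryPoint, tauMinus_flow_neg hF hΩ ht h, flow_flow hF, entryPoint,
    ENNReal.toReal_sub_of_le hlt.le hτ.ne, ENNReal.toReal_ofReal ht]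
  congr 1; ring

lemma entryPoint_notMem (hF : LipschitzWith κ F) (hΩ : IsOpen Ω) {x : Phase N} (hx : x ∈ Ω)
    (hτ : tauMinus F Ω x < ∞) : entryPoint F Ω x ∉ Ω := by
  intro h
  have hpos := tauMinus_toReal_pos hF hΩ hx hτ
  have : (x, -(tauMinus F Ω x).toReal) ∈ stayDomain F Ω := by
    rw [mem_stayDomain_neg hpos.le]
    intro s hs
    rcases hs.2.eq_or_lt with rfl | hs'
    · exact h
    · exact flow_mem_of_mem_stayDomain ((lt_tauMinus_toReal_iff hF hΩ hx hτ hs.1).1 hs')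
  exact lt_irrefl _ ((lt_tauMinus_toReal_iff hF hΩ hx hτ hpos.le).2 this)

/-- The characteristic issued from the entry point of `x`. -/
lemma flow_entryPoint (hF : LipschitzWith κ F) (x : Phase N) (t : ℝ) :
    flow F (entryPoint F Ω x) t = flow F x (-((tauMinus F Ω x).toReal - t)) := by
  rw [entryPoint, flow_flow hF]; congr 1; ring

lemma entryPoint_mem_incomingBoundary (hF : LipschitzWith κ F) (hΩ : IsOpen Ω) {x : Phase N}
    (hx : x ∈ Ω) (hτ : tauMinus F Ω x < ∞) : entryPoint F Ω x ∈ incomingBoundary F Ω := by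
  refine ⟨?_, x, hx, hτ, rfl⟩
  have hpos := tauMinus_toReal_pos hF hΩ hx hτ
  rw [hΩ.frontier_eq]
  refine ⟨?_, entryPoint_notMem hF hΩ hx hτ⟩
  have hc : Tendsto (fun t => flow F (entryPoint F Ω x) t) (𝓝[>] 0)
      (𝓝 (entryPoint F Ω x)) := by
    have := (continuous_flow_right hF (entryPoint F Ω x)).tendsto 0
    rw [flow_zero hF] at this
    exact this.mono_left nhdsWithin_le_nhds
  refine mem_closure_of_tendsto hc ?_
  filter_upwards [Ioo_mem_nhdsGT hpos] with t ht
  rw [flow_entryPoint hF]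
  exact flow_mem_of_mem_stayDomain
    ((lt_tauMinus_toReal_iff hF hΩ hx hτ (by linarith [ht.2])).1 (by linarith [ht.1]))

/-- On `Ω`, the time `τ₋` agrees with a measurable function. -/
lemma exists_measurable_eq_tauMinus (hF : LipschitzWith κ F) (hΩ : IsOpen Ω) :
    ∃ τ : Phase N → ℝ≥0∞, Measurable τ ∧ ∀ x ∈ Ω, tauMinus F Ω x = τ x := by
  -- A supremum over rational times keeps the function measurable. Off `Ω` it need not agree with
  -- `τ₋`, hence the formulation on `Ω` only.
  refine ⟨fun x => ⨆ q : ℚ, {z | 0 ≤ (q : ℝ) ∧ (z, -(q : ℝ)) ∈ stayDomain F Ω}.indicator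
    (fun _ => ENNReal.ofReal q) x, Measurable.iSup fun q => measurable_const.indicator ?_,
    fun x hx => le_antisymm ?_ (iSup_le fun q => ?_)⟩
  · refine (MeasurableSet.const _).inter ?_
    exact ((isOpen_stayDomain hF hΩ).preimage
      (by fun_prop : Continuous fun z : Phase N => (z, -(q : ℝ)))).measurableSet
  · refine le_of_forall_lt fun c hc => ?_
    obtain ⟨q, hq, hcq, hqτ⟩ := ENNReal.lt_iff_exists_rat_btwn.1 hc
    have hq' : (0 : ℝ) ≤ q := by exact_mod_cast hq
    refine lt_of_lt_of_le hcq (le_iSup_of_le q ?_)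
    rw [indicator_of_mem]
    · exact le_rfl
    · exact ⟨hq', (ofReal_lt_tauMinus_iff hF hΩ hx hq').1 hqτ⟩
  · refine indicator_apply_le' (fun h => ?_) fun _ => zero_le
    exact ((ofReal_lt_tauMinus_iff hF hΩ hx h.1).2 h.2).le

lemma exists_measurable_eq_entryPoint (hF : LipschitzWith κ F) (hΩ : IsOpen Ω) :
    ∃ e : Phase N → Phase N, Measurable e ∧ ∀ x ∈ Ω, entryPoint F Ω x = e x := by
  obtain ⟨τ, hτ, h⟩ := exists_measurable_eq_tauMinus hF hΩ
  exact ⟨fun x => flow F x (-(τ x).toReal),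
    (measurable_flow hF).comp (measurable_id.prodMk hτ.ennreal_toReal.neg),
    fun x hx => by rw [entryPoint, h x hx]⟩

lemma measurableSet_tauMinus_lt (hF : LipschitzWith κ F) (hΩ : IsOpen Ω) (c : ℝ≥0∞) :
    MeasurableSet {x | x ∈ Ω ∧ tauMinus F Ω x < c} := by
  obtain ⟨τ, hτ, h⟩ := exists_measurable_eq_tauMinus hF hΩ
  have : {x | x ∈ Ω ∧ tauMinus F Ω x < c} = Ω ∩ {x | τ x < c} := by
    ext x
    exact and_congr_right fun hx => by rw [h x hx]; rfl
  rw [this]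
  exact hΩ.measurableSet.inter (measurableSet_lt hτ measurable_const)

/-! ### Invariance and Fubini along characteristics -/

lemma measurableEmbedding_flow (hF : LipschitzWith κ F) (t : ℝ) :
    MeasurableEmbedding fun x => flow F x t :=
  (Homeomorph.mk ⟨fun x => flow F x t, fun x => flow F x (-t),
    fun x => flow_neg_flow hF x t, fun x => flow_flow_neg hF x t⟩
    (continuous_flow_left hF t) (continuous_flow_left hF (-t))).measurableEmbedding

lemma integral_comp_flow (hF : LipschitzWith κ F) (hμ : FlowInvariant F μ) (h : Phase N → ℝ)
    (t : ℝ) : ∫ x, h (flow F x t) ∂μ = ∫ x, h x ∂μ :=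
  (measurePreserving_flow hF hμ t).integral_comp (measurableEmbedding_flow hF t) h

lemma integrable_comp_flow (hF : LipschitzWith κ F) (hμ : FlowInvariant F μ) {h : Phase N → ℝ}
    (hh : Integrable h μ) (t : ℝ) : Integrable (fun x => h (flow F x t)) μ :=
  (measurePreserving_flow hF hμ t).integrable_comp_of_integrable hh

lemma ae_comp_flow (hF : LipschitzWith κ F) (hμ : FlowInvariant F μ) {p : Phase N → Prop}
    (hp : ∀ᵐ x ∂μ, p x) (t : ℝ) : ∀ᵐ x ∂μ, p (flow F x t) :=
  (measurePreserving_flow hF hμ t).quasiMeasurePreserving.ae hp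

lemma integrable_comp_flow_prod [IsFiniteMeasureOnCompacts μ] (hF : LipschitzWith κ F)
    (hμ : FlowInvariant F μ) {h : Phase N → ℝ} (hm : StronglyMeasurable h)
    (hh : Integrable h μ) (ν : Measure ℝ) [IsFiniteMeasure ν] {θ : ℝ → ℝ} (hθ : Measurable θ) :
    Integrable (fun p : Phase N × ℝ => h (flow F p.1 (θ p.2))) (μ.prod ν) := by
  have hm' : AEStronglyMeasurable (fun p : Phase N × ℝ => h (flow F p.1 (θ p.2)))
      (μ.prod ν) :=
    (hm.comp_measurable ((measurable_flow hF).comp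
      (measurable_fst.prodMk (hθ.comp measurable_snd)))).aestronglyMeasurable
  -- Slicing at fixed time: by invariance all slices have the same `L¹` norm, and `ν` is finite.
  rw [integrable_prod_iff' hm']
  refine ⟨Eventually.of_forall fun s => integrable_comp_flow hF hμ hh (θ s), ?_⟩
  simp only [integral_comp_flow hF hμ (fun x => ‖h x‖)]
  exact integrable_const _

/-- Along almost every characteristic an integrable function is locally integrable. -/
lemma ae_intervalIntegrable_comp_flow [IsFiniteMeasureOnCompacts μ] (hF : LipschitzWith κ F)
    (hμ : FlowInvariant F μ) {h : Phase N → ℝ} (hm : StronglyMeasurable h)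
    (hh : Integrable h μ) :
    ∀ᵐ x ∂μ, ∀ a b : ℝ, IntervalIntegrable (fun s => h (flow F x s)) volume a b := by
  have key : ∀ n : ℕ, ∀ᵐ x ∂μ,
      IntegrableOn (fun s => h (flow F x s)) (Icc (-n : ℝ) n) volume := fun n =>
    (integrable_comp_flow_prod hF hμ hm hh (volume.restrict (Icc (-n : ℝ) n))
      measurable_id).prod_right_ae
  filter_upwards [ae_all_iff.2 key] with x hx a b
  obtain ⟨n, hn⟩ := exists_nat_ge (max |a| |b|)
  rw [intervalIntegrable_iff]
  refine (hx n).mono_set (uIoc_subset_uIcc.trans (uIcc_subset_Icc ?_ ?_))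
  · exact abs_le.1 ((le_max_left _ _).trans hn)
  · exact abs_le.1 ((le_max_right _ _).trans hn)

/-- If a property holds almost everywhere, it holds at almost all times along almost every
characteristic. -/
lemma ae_ae_comp_flow [IsFiniteMeasureOnCompacts μ] (hF : LipschitzWith κ F)
    (hμ : FlowInvariant F μ) {p : Phase N → Prop} (hp : ∀ᵐ x ∂μ, p x) :
    ∀ᵐ x ∂μ, ∀ᵐ t : ℝ, p (flow F x t) := by
  -- The exceptional set is enlarged to a measurable null set, since exchanging the two quantifiers
  -- by Fubini needs joint measurability.
  obtain ⟨s, hs, hsm, hs0⟩ := exists_measurable_superset_of_null (ae_iff.1 hp)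
  have hs' : ∀ᵐ x ∂μ, x ∉ s := compl_mem_ae_iff.2 hs0
  have h2 : ∀ᵐ x ∂μ, ∀ᵐ t : ℝ, flow F x t ∉ s := by
    rw [Measure.ae_ae_comm (p := fun x t => flow F x t ∉ s)
      ((measurable_flow hF) hsm.compl)]
    exact Eventually.of_forall fun t => ae_comp_flow hF hμ hs' t
  filter_upwards [h2] with x hx
  filter_upwards [hx] with t ht
  by_contra hc
  exact ht (hs hc)

/-! ### The weak equation integrated along characteristics -/

/-- The extension by zero outside of `Ω`. -/
def zeroExt (Ω : Set (Phase N)) (f : L1Space Ω μ) : Phase N → ℝ := Ω.indicator f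

lemma zeroExt_of_mem (f : L1Space Ω μ) {x : Phase N} (hx : x ∈ Ω) : zeroExt Ω f x = f x :=
  indicator_of_mem hx _

lemma stronglyMeasurable_zeroExt (hΩ : IsOpen Ω) (f : L1Space Ω μ) :
    StronglyMeasurable (zeroExt Ω f) :=
  (Lp.stronglyMeasurable f).indicator hΩ.measurableSet

lemma integrable_zeroExt (hΩ : IsOpen Ω) (f : L1Space Ω μ) : Integrable (zeroExt Ω f) μ :=
  (integrable_indicator_iff hΩ.measurableSet).2 (L1.integrable_coeFn f)

lemma setIntegral_mul_eq_zeroExt (hΩ : IsOpen Ω) (f : L1Space Ω μ) (ψ : Phase N → ℝ) :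
    ∫ x in Ω, f x * ψ x ∂μ = ∫ x, zeroExt Ω f x * ψ x ∂μ := by
  rw [← integral_indicator hΩ.measurableSet]
  simp only [zeroExt, indicator_mul_left]

/-- The integral of `φ` along the characteristic arriving at `x`, over a time `t`. -/
def timeIntegral (F : Phase N → Phase N) (φ : Phase N → ℝ) (t : ℝ) (x : Phase N) : ℝ :=
  ∫ s in (0 : ℝ)..t, φ (flow F x (-s))

/-- Along the characteristic through `x` the time integral is `∫_{r-t}^r φ(Φ(x,u)) du`, a moving
window with continuous integrand. -/
lemma hasDerivAt_timeIntegral_flow (hF : LipschitzWith κ F) {φ : Phase N → ℝ}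
    (hφ : Continuous φ) (t : ℝ) (x : Phase N) (r : ℝ) :
    HasDerivAt (fun r => timeIntegral F φ t (flow F x r))
      (φ (flow F x r) - φ (flow F x (r - t))) r := by
  have hq : Continuous fun u => φ (flow F x u) := hφ.comp (continuous_flow_right hF x)
  have h1 : (fun r => timeIntegral F φ t (flow F x r)) = fun r =>
      (∫ u in (0 : ℝ)..r, φ (flow F x u)) - ∫ u in (0 : ℝ)..(r - t), φ (flow F x u) := by
    funext r
    rw [timeIntegral, intervalIntegral.integral_interval_sub_left (hq.intervalIntegrable _ _)
      (hq.intervalIntegrable _ _)]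
    simp only [flow_flow hF, ← sub_eq_add_neg]
    rw [intervalIntegral.integral_comp_sub_left (fun u => φ (flow F x u)) r, sub_zero]
  rw [h1]
  have hd := fun r => (hq.integral_hasStrictDerivAt 0 r).hasDerivAt
  exact (hd r).sub ((hd (r - t)).comp_sub_const r t)

lemma charDeriv_timeIntegral (hF : LipschitzWith κ F) {φ : Phase N → ℝ}
    (hφ : Continuous φ) (t : ℝ) (x : Phase N) :
    charDeriv F (timeIntegral F φ t) x = φ x - φ (flow F x (-t)) := by
  rw [charDeriv, (hasDerivAt_timeIntegral_flow hF hφ t x 0).deriv, flow_zero hF, zero_sub]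

/-- The function vanishes off the image of `tsupport φ × [0,t]` under the flow. That set is compact,
and it lies in `Ω` precisely because points of `tsupport φ` stay in `Ω` up to time `t`. -/
lemma isTestFunction_timeIntegral (hF : LipschitzWith κ F)
    {φ : Phase N → ℝ} (hφ : Continuous φ) (hc : HasCompactSupport φ) {t : ℝ} (ht : 0 ≤ t)
    (hsupp : ∀ x ∈ tsupport φ, (x, t) ∈ stayDomain F Ω) :
    IsTestFunction F Ω μ (timeIntegral F φ t) := by
  obtain ⟨C, hC⟩ := hφ.bounded_above_of_compact_support hc
  have hcont : Continuous (timeIntegral F φ t) := by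
    refine intervalIntegral.continuous_parametric_intervalIntegral_of_continuous' ?_ 0 t
    exact hφ.comp ((continuous_flow hF).comp
      (by fun_prop : Continuous fun p : Phase N × ℝ => (p.1, -p.2)))
  refine ⟨hcont.measurable.comp measurable_subtype_coe, ⟨C * |t|, fun x _ => ?_⟩,
    ⟨(fun p : Phase N × ℝ => flow F p.1 p.2) '' (tsupport φ ×ˢ Icc 0 t), ?_, ?_, ?_⟩,
    fun x _ => ContDiff.contDiffOn ?_, ?_, ⟨C + C, fun x _ => ?_⟩⟩
  · have := intervalIntegral.norm_integral_le_of_norm_le_const (a := 0) (b := t)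
      (f := fun s => φ (flow F x (-s))) (C := C) fun s _ => hC _
    simpa [timeIntegral] using this
  · exact (hc.isCompact.prod isCompact_Icc).image (continuous_flow hF)
  · rintro _ ⟨⟨x, s⟩, ⟨hx, hs⟩, rfl⟩
    exact (mem_stayDomain_of_nonneg ht).1 (hsupp x hx) s hs
  · refine Eventually.of_forall fun x hx => ?_
    rw [timeIntegral, intervalIntegral.integral_congr (g := fun _ => 0)]
    · simp
    · intro s hs
      rw [uIcc_of_le ht] at hs
      by_contra h
      exact hx ⟨(flow F x (-s), s), ⟨subset_tsupport _ h, hs⟩, flow_flow_neg hF x s⟩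
  · rw [contDiff_one_iff_deriv]
    have h := hasDerivAt_timeIntegral_flow hF hφ t x
    refine ⟨fun r => (h r).differentiableAt, ?_⟩
    rw [funext fun r => (h r).deriv]
    have hq : Continuous fun u => φ (flow F x u) := hφ.comp (continuous_flow_right hF x)
    exact hq.sub (hq.comp (continuous_id.sub continuous_const))
  · simp only [charDeriv_timeIntegral hF hφ]
    exact ((hφ.sub (hφ.comp (continuous_flow_left hF (-t)))).measurable).comp
      measurable_subtype_coe
  · rw [charDeriv_timeIntegral hF hφ]
    exact (abs_sub _ _).trans (add_le_add (hC _) (hC _))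

/-- Fubini on both sides, then the substitution `x ↦ Φ(x,s)` at each fixed `s` moves the flow from
`φ` to `g`. -/
lemma integral_mul_timeIntegral [IsFiniteMeasureOnCompacts μ] (hF : LipschitzWith κ F)
    (hμ : FlowInvariant F μ) {g φ : Phase N → ℝ} (hm : StronglyMeasurable g)
    (hg : Integrable g μ) (hφ : Continuous φ) (hc : HasCompactSupport φ) {t : ℝ} (ht : 0 ≤ t) :
    ∫ x, g x * timeIntegral F φ t x ∂μ
      = ∫ x, φ x * ∫ s in (0 : ℝ)..t, g (flow F x s) ∂volume ∂μ := by
  obtain ⟨C, hC⟩ := hφ.bounded_above_of_compact_support hc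
  have hi1 : Integrable (fun p : Phase N × ℝ => g p.1 * φ (flow F p.1 (-p.2)))
      (μ.prod (volume.restrict (Ioc 0 t))) :=
    (hg.comp_fst _).mul_bdd (hφ.comp ((continuous_flow hF).comp
      (by fun_prop : Continuous fun p : Phase N × ℝ => (p.1, -p.2)))).aestronglyMeasurable
      (Eventually.of_forall fun _ => hC _)
  have hi2 : Integrable (fun p : Phase N × ℝ => φ p.1 * g (flow F p.1 p.2))
      (μ.prod (volume.restrict (Ioc 0 t))) :=
    (integrable_comp_flow_prod hF hμ hm hg _ measurable_id).bdd_mul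
      (hφ.comp continuous_fst).aestronglyMeasurable (Eventually.of_forall fun _ => hC _)
  simp only [timeIntegral, intervalIntegral.integral_of_le ht, ← integral_const_mul]
  rw [integral_integral_swap (f := fun x s => g x * φ (flow F x (-s))) hi1,
    integral_integral_swap (f := fun x s => φ x * g (flow F x s)) hi2]
  congr 1
  funext s
  rw [← integral_comp_flow hF hμ (fun x => g x * φ (flow F x (-s))) s]
  simp only [flow_neg_flow hF, mul_comm]

/-- The weak formulation integrated along the characteristics, over a positive time. -/
lemma ae_sub_eq_integral_of_maxTransport [IsFiniteMeasureOnCompacts μ] (hF : LipschitzWith κ F)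
    (hμ : FlowInvariant F μ) (hΩ : IsOpen Ω) {f g : L1Space Ω μ}
    (hfg : (f, g) ∈ maxTransport F Ω μ) {t : ℝ} (ht : 0 ≤ t) :
    ∀ᵐ x ∂μ, (x, t) ∈ stayDomain F Ω →
      zeroExt Ω f (flow F x t)
        = zeroExt Ω f x - ∫ s in (0 : ℝ)..t, zeroExt Ω g (flow F x s) := by
  have hf := integrable_zeroExt hΩ f
  have hg := integrable_zeroExt hΩ g
  have hft := integrable_comp_flow hF hμ hf t
  have hG : Integrable (fun x => ∫ s in (0 : ℝ)..t, zeroExt Ω g (flow F x s)) μ := by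
    simp only [intervalIntegral.integral_of_le ht]
    exact (integrable_comp_flow_prod hF hμ (stronglyMeasurable_zeroExt hΩ g) hg
      (volume.restrict (Ioc 0 t)) measurable_id).integral_prod_left
  have hU : IsOpen {x | (x, t) ∈ stayDomain F Ω} :=
    (isOpen_stayDomain hF hΩ).preimage (by fun_prop : Continuous fun x : Phase N => (x, t))
  -- Fundamental lemma of the calculus of variations on the open set of points staying in `Ω` up to
  -- time `t`; the function shown to vanish there is `f - f(Φ(·,t)) - ∫₀ᵗ g(Φ(·,s)) ds`.
  have key := hU.ae_eq_zero_of_integral_contDiff_smul_eq_zero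
    (((hf.sub hft).sub hG).locallyIntegrable.locallyIntegrableOn _) fun φ hφ hc hsupp => by
      have hφc := hφ.continuous
      obtain ⟨C, hC⟩ := hφc.bounded_above_of_compact_support hc
      have hbd : ∀ {h : Phase N → ℝ}, Integrable h μ → Integrable (fun x => φ x * h x) μ :=
        fun hh => hh.bdd_mul hφc.aestronglyMeasurable (Eventually.of_forall hC)
      have h := hfg _ (isTestFunction_timeIntegral hF hφc hc ht hsupp)
      rw [setIntegral_mul_eq_zeroExt hΩ, setIntegral_mul_eq_zeroExt hΩ,
        integral_mul_timeIntegral hF hμ (stronglyMeasurable_zeroExt hΩ g) hg hφc hc ht] at h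
      simp only [charDeriv_timeIntegral hF hφc, mul_sub] at h
      have hshift : ∫ x, zeroExt Ω f x * φ (flow F x (-t)) ∂μ
          = ∫ x, φ x * zeroExt Ω f (flow F x t) ∂μ := by
        rw [← integral_comp_flow hF hμ (fun x => zeroExt Ω f x * φ (flow F x (-t))) t]
        simp only [flow_neg_flow hF, mul_comm]
      have hi : Integrable (fun x => zeroExt Ω f x * φ (flow F x (-t))) μ :=
        hf.mul_bdd (hφc.comp (continuous_flow_left hF (-t))).aestronglyMeasurable
          (Eventually.of_forall fun _ => hC _)
      rw [integral_sub (by simpa only [mul_comm] using hbd hf) hi, hshift] at h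
      simp only [Pi.sub_apply, smul_eq_mul, mul_sub]
      rw [integral_sub (by exact (hbd hf).sub (hbd hft)) (hbd hG),
        integral_sub (hbd hf) (hbd hft), h]
      simp only [mul_comm, sub_self]
  filter_upwards [key] with x hx hxt
  have := hx hxt
  simp only [Pi.sub_apply] at this
  linarith

/-- The weak formulation integrated along the characteristics. -/
lemma ae_eq_sub_integral_of_maxTransport [IsFiniteMeasureOnCompacts μ] (hF : LipschitzWith κ F)
    (hμ : FlowInvariant F μ) (hΩ : IsOpen Ω) {f g : L1Space Ω μ}
    (hfg : (f, g) ∈ maxTransport F Ω μ) (t : ℝ) :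
    ∀ᵐ x ∂μ, (x, t) ∈ stayDomain F Ω →
      zeroExt Ω f (flow F x t)
        = zeroExt Ω f x - ∫ s in (0 : ℝ)..t, zeroExt Ω g (flow F x s) := by
  rcases le_total 0 t with ht | ht
  · exact ae_sub_eq_integral_of_maxTransport hF hμ hΩ hfg ht
  -- For `t ≤ 0` the forward relation over time `-t` is applied at the starting point `Φ(x,t)`.
  · have h := ae_sub_eq_integral_of_maxTransport hF hμ hΩ hfg (by linarith : 0 ≤ -t)
    filter_upwards [ae_comp_flow hF hμ h t] with x hx hxt
    have := hx ((stayDomain_flow_symm hF).2 hxt)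
    simp only [flow_flow hF, add_neg_cancel, flow_zero hF] at this
    rw [intervalIntegral.integral_comp_add_left (fun s => zeroExt Ω g (flow F x s)) t,
      add_zero, add_neg_cancel, intervalIntegral.integral_symm] at this
    linarith

/-! ### Regular points and mild representatives -/

/-- Points of `Ω` along whose characteristic the weak relation between `f` and `g` holds in
integrated form, at almost all times. -/
structure IsRegularPoint (F : Phase N → Phase N) (f g : L1Space Ω μ) (x : Phase N) : Prop where
  mem : x ∈ Ω
  intervalIntegrable : ∀ a b : ℝ,
    IntervalIntegrable (fun s => zeroExt Ω g (flow F x s)) volume a b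
  ae_eq : ∀ᵐ t : ℝ, (x, t) ∈ stayDomain F Ω →
    zeroExt Ω f (flow F x t) = zeroExt Ω f x - ∫ s in (0 : ℝ)..t, zeroExt Ω g (flow F x s)

/-- Splitting the oriented integral into its parts over `(0,t]` and `(t,0]` leaves parametric
integrals of jointly measurable functions. -/
lemma stronglyMeasurable_integral_flow (hF : LipschitzWith κ F) {g : Phase N → ℝ}
    (hm : StronglyMeasurable g) :
    StronglyMeasurable fun p : Phase N × ℝ => ∫ s in (0 : ℝ)..p.2, g (flow F p.1 s) := by
  have hk : StronglyMeasurable fun q : (Phase N × ℝ) × ℝ => g (flow F q.1.1 q.2) :=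
    hm.comp_measurable ((measurable_flow hF).comp
      (by fun_prop : Measurable fun q : (Phase N × ℝ) × ℝ => (q.1.1, q.2)))
  have h1 : MeasurableSet {q : (Phase N × ℝ) × ℝ | q.2 ∈ Ioc 0 q.1.2} :=
    (measurableSet_lt measurable_const measurable_snd).inter
      (measurableSet_le measurable_snd (by fun_prop))
  have h2 : MeasurableSet {q : (Phase N × ℝ) × ℝ | q.2 ∈ Ioc q.1.2 0} :=
    (measurableSet_lt (by fun_prop) measurable_snd).inter
      (measurableSet_le measurable_snd measurable_const)
  have e1 := (hk.indicator h1).integral_prod_right' (ν := (volume : Measure ℝ))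
  have e2 := (hk.indicator h2).integral_prod_right' (ν := (volume : Measure ℝ))
  convert e1.sub e2 using 1
  funext p
  simp only [intervalIntegral, Pi.sub_apply, ← integral_indicator measurableSet_Ioc]
  rfl

/-- The integrated relation has an exceptional set depending on `t`; Fubini exchanges "every `t`,
almost every `x`" for "almost every `x`, almost every `t`". -/
lemma ae_isRegularPoint [IsFiniteMeasureOnCompacts μ] (hF : LipschitzWith κ F)
    (hμ : FlowInvariant F μ) (hΩ : IsOpen Ω) {f g : L1Space Ω μ}
    (hfg : (f, g) ∈ maxTransport F Ω μ) : ∀ᵐ x ∂μ, x ∈ Ω → IsRegularPoint F f g x := by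
  have hm := stronglyMeasurable_zeroExt hΩ f
  have hmeas : MeasurableSet {p : Phase N × ℝ | (p.1, p.2) ∈ stayDomain F Ω →
      zeroExt Ω f (flow F p.1 p.2)
        = zeroExt Ω f p.1 - ∫ s in (0 : ℝ)..p.2, zeroExt Ω g (flow F p.1 s)} := by
    refine (isOpen_stayDomain hF hΩ).measurableSet.imp (measurableSet_eq_fun
      (hm.measurable.comp (measurable_flow hF)) ((hm.measurable.comp measurable_fst).sub
      (stronglyMeasurable_integral_flow hF (stronglyMeasurable_zeroExt hΩ g)).measurable))
  have h := (Measure.ae_ae_comm (μ := μ) (ν := (volume : Measure ℝ)) (p := fun x t =>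
    (x, t) ∈ stayDomain F Ω → zeroExt Ω f (flow F x t)
        = zeroExt Ω f x - ∫ s in (0 : ℝ)..t, zeroExt Ω g (flow F x s)) hmeas).2
    (Eventually.of_forall fun t => ae_eq_sub_integral_of_maxTransport hF hμ hΩ hfg t)
  filter_upwards [h, ae_intervalIntegrable_comp_flow hF hμ (stronglyMeasurable_zeroExt hΩ g)
    (integrable_zeroExt hΩ g)] with x h1 h2 hx
  exact ⟨hx, h2, h1⟩

/-- The representative of a function obtained by averaging along the characteristics. -/
def charMean (F : Phase N → Phase N) (h : Phase N → ℝ) (x : Phase N) : ℝ :=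
  limUnder atTop fun n : ℕ =>
    ((1 : ℝ) / (n + 1))⁻¹ * ∫ s in (0 : ℝ)..(1 / (n + 1)), h (flow F x s)

lemma isOpen_stayTimes (hF : LipschitzWith κ F) (hΩ : IsOpen Ω) (x : Phase N) :
    IsOpen {t : ℝ | (x, t) ∈ stayDomain F Ω} :=
  (isOpen_stayDomain hF hΩ).preimage (by fun_prop : Continuous fun t : ℝ => (x, t))

lemma IsRegularPoint.continuous_primitive {f g : L1Space Ω μ} {x : Phase N}
    (h : IsRegularPoint F f g x) :
    Continuous fun t : ℝ => zeroExt Ω f x - ∫ s in (0 : ℝ)..t, zeroExt Ω g (flow F x s) :=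
  continuous_const.sub (intervalIntegral.continuous_primitive h.intervalIntegrable 0)

/-- For short windows the forward averages of `f` equal those of the continuous primitive, which `f`
matches at almost all times, and these converge to its value. So the relation holds at every stay
time, including those where the chosen representative of `f` is wrong. -/
lemma IsRegularPoint.charMean_flow (hF : LipschitzWith κ F) (hΩ : IsOpen Ω) {f g : L1Space Ω μ}
    {x : Phase N} (h : IsRegularPoint F f g x) {t : ℝ} (ht : (x, t) ∈ stayDomain F Ω) :
    charMean F (zeroExt Ω f) (flow F x t)
      = zeroExt Ω f x - ∫ s in (0 : ℝ)..t, zeroExt Ω g (flow F x s) := by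
  set q := fun t : ℝ => zeroExt Ω f x - ∫ s in (0 : ℝ)..t, zeroExt Ω g (flow F x s) with hq
  have hqc : Continuous q := h.continuous_primitive
  refine Tendsto.limUnder_eq ?_
  have hd := hasDerivAt_iff_tendsto_slope_zero.1 (hqc.integral_hasStrictDerivAt 0 t).hasDerivAt
  have hseq : Tendsto (fun n : ℕ => (1 : ℝ) / (n + 1)) atTop (𝓝[≠] 0) :=
    tendsto_nhdsWithin_iff.2 ⟨tendsto_one_div_add_atTop_nhds_zero_nat,
      Eventually.of_forall fun n => (Nat.one_div_pos_of_nat).ne'⟩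
  refine (hd.comp hseq).congr' ?_
  obtain ⟨ε, hε, hb⟩ := Metric.isOpen_iff.1 (isOpen_stayTimes hF hΩ x) t ht
  filter_upwards [tendsto_one_div_add_atTop_nhds_zero_nat.eventually_lt_const hε] with n hn
  have hpos : (0 : ℝ) < 1 / (n + 1) := Nat.one_div_pos_of_nat
  simp only [Function.comp_apply, smul_eq_mul]
  congr 1
  rw [intervalIntegral.integral_interval_sub_left (hqc.intervalIntegrable _ _)
    (hqc.intervalIntegrable _ _)]
  simp only [flow_flow hF]
  rw [intervalIntegral.integral_comp_add_left (fun s => zeroExt Ω f (flow F x s)) t, add_zero]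
  refine intervalIntegral.integral_congr_ae ?_
  filter_upwards [h.ae_eq] with s hs hst
  rw [uIoc_of_le (by linarith)] at hst
  refine (hs (hb ?_)).symm
  rw [Metric.mem_ball, Real.dist_eq, abs_lt]
  constructor <;> linarith [hst.1, hst.2]

lemma isMildRepresentative_charMean [IsFiniteMeasureOnCompacts μ] (hF : LipschitzWith κ F)
    (hμ : FlowInvariant F μ) (hΩ : IsOpen Ω) {f g : L1Space Ω μ}
    (hfg : (f, g) ∈ maxTransport F Ω μ) :
    IsMildRepresentative F Ω μ f g (charMean F (zeroExt Ω f)) := by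
  have hreg := (ae_restrict_iff' hΩ.measurableSet).2 (ae_isRegularPoint hF hμ hΩ hfg)
  constructor
  · filter_upwards [hreg] with x hx
    have := hx.charMean_flow hF hΩ ((mem_stayDomain_zero hF).2 hx.mem)
    rw [flow_zero hF, intervalIntegral.integral_same, sub_zero, zeroExt_of_mem f hx.mem] at this
    exact this.symm
  · filter_upwards [hreg] with x hx t₁ h₁ t₂ h₂ h12
    rw [mem_stayInterval_iff hF hΩ hx.mem] at h₁ h₂
    have heq : ∀ s ∈ uIcc t₁ t₂, zeroExt Ω g (flow F x s) = g (flow F x s) := fun s hs =>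
      zeroExt_of_mem g (flow_mem_of_mem_stayDomain (mem_stayDomain_of_uIcc h₁ h₂ hs))
    refine ⟨(hx.intervalIntegrable t₁ t₂).congr fun s hs => heq s (uIoc_subset_uIcc hs), ?_⟩
    rw [hx.charMean_flow hF hΩ h₁, hx.charMean_flow hF hΩ h₂,
      ← intervalIntegral.integral_congr heq, sub_sub_sub_cancel_left,
      intervalIntegral.integral_interval_sub_left (hx.intervalIntegrable _ _)
        (hx.intervalIntegrable _ _)]

/-- Near `t` the function is a constant minus a primitive based at the slightly earlier time `t -
ε/2`. -/
lemma continuousOn_of_mild (hF : LipschitzWith κ F) (hΩ : IsOpen Ω) {g fs : Phase N → ℝ}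
    {x : Phase N} (hx : x ∈ Ω)
    (h : ∀ t₁ ∈ stayInterval F Ω x, ∀ t₂ ∈ stayInterval F Ω x, t₁ ≤ t₂ →
      IntervalIntegrable (fun s : ℝ => g (flow F x s)) volume t₁ t₂ ∧
      fs (flow F x t₁) - fs (flow F x t₂) = ∫ s in t₁..t₂, g (flow F x s)) :
    ContinuousOn (fun t => fs (flow F x t)) {t | (x, t) ∈ stayDomain F Ω} := by
  intro t ht
  refine ContinuousAt.continuousWithinAt ?_
  obtain ⟨ε, hε, hb⟩ := Metric.isOpen_iff.1 (isOpen_stayTimes hF hΩ x) t ht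
  have hI : ∀ s ∈ Icc (t - ε / 2) (t + ε / 2), s ∈ stayInterval F Ω x := fun s hs => by
    rw [mem_stayInterval_iff hF hΩ hx]
    refine hb ?_
    rw [Metric.mem_ball, Real.dist_eq, abs_lt]
    constructor <;> linarith [hs.1, hs.2]
  have hle : t - ε / 2 ≤ t + ε / 2 := by linarith
  have hc : ContinuousOn (fun s => fs (flow F x (t - ε / 2))
      - ∫ r in (t - ε / 2)..s, g (flow F x r)) (Icc (t - ε / 2) (t + ε / 2)) := by
    refine continuousOn_const.sub ?_
    have hi : IntegrableOn (fun s => g (flow F x s)) (uIcc (t - ε / 2) (t + ε / 2)) := by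
      rw [uIcc_of_le hle, ← intervalIntegrable_iff_integrableOn_Icc_of_le hle]
      exact (h _ (hI _ (left_mem_Icc.2 hle)) _ (hI _ (right_mem_Icc.2 hle)) hle).1
    have := intervalIntegral.continuousOn_primitive_interval hi
    rwa [uIcc_of_le hle] at this
  refine (hc.congr fun s hs => ?_).continuousAt (Icc_mem_nhds (by linarith) (by linarith))
  have := (h _ (hI _ (left_mem_Icc.2 hle)) s (hI _ hs) hs.1).2
  linarith

/-- Two mild representatives of a function agree along almost every characteristic. -/
lemma IsMildRepresentative.ae_eq_along [IsFiniteMeasureOnCompacts μ] (hF : LipschitzWith κ F)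
    (hμ : FlowInvariant F μ) (hΩ : IsOpen Ω) {f g g' : L1Space Ω μ} {fs fs' : Phase N → ℝ}
    (h : IsMildRepresentative F Ω μ f g fs) (h' : IsMildRepresentative F Ω μ f g' fs') :
    ∀ᵐ x ∂μ, x ∈ Ω → ∀ t, (x, t) ∈ stayDomain F Ω → fs' (flow F x t) = fs (flow F x t) := by
  have heq : ∀ᵐ x ∂μ, x ∈ Ω → fs' x = fs x := by
    rw [← ae_restrict_iff' hΩ.measurableSet]
    exact h'.1.symm.trans h.1
  filter_upwards [ae_ae_comp_flow hF hμ heq, (ae_restrict_iff' hΩ.measurableSet).1 h.2,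
    (ae_restrict_iff' hΩ.measurableSet).1 h'.2] with x h1 h2 h3 hx
  -- Both representatives are continuous along the characteristic, so agreement at almost all times
  -- is agreement at all times. The functions `g` and `g'` need not be compared.
  refine Measure.eqOn_open_of_ae_eq (μ := volume) ?_ (isOpen_stayTimes hF hΩ x)
    (continuousOn_of_mild hF hΩ hx (h3 hx)) (continuousOn_of_mild hF hΩ hx (h2 hx))
  refine (ae_restrict_iff' (isOpen_stayTimes hF hΩ x).measurableSet).2 ?_
  filter_upwards [h1] with t ht htx
  exact ht (flow_mem_of_mem_stayDomain htx)

/-! ### The boundary measure and the incoming trace -/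

lemma aemeasurable_entryPoint (hF : LipschitzWith κ F) (hΩ : IsOpen Ω) (c : ℝ≥0∞) :
    AEMeasurable (entryPoint F Ω) (μ.restrict {x | x ∈ Ω ∧ tauMinus F Ω x < c}) := by
  obtain ⟨e, he, h⟩ := exists_measurable_eq_entryPoint hF hΩ
  refine ⟨e, he, ?_⟩
  filter_upwards [ae_restrict_mem (measurableSet_tauMinus_lt hF hΩ c)] with x hx
  exact h x hx.1

/-- A property of almost every boundary point holds at the entry points of almost every
characteristic. -/
lemma ae_entryPoint_of_ae_incomingMeasure (hF : LipschitzWith κ F) (hμ : FlowInvariant F μ)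
    (hΩ : IsOpen Ω) {p : Phase N → Prop} (hp : ∀ᵐ y ∂(incomingMeasure F Ω μ), p y) :
    ∀ᵐ x ∂μ, x ∈ Ω → tauMinus F Ω x < ∞ → p (entryPoint F Ω x) := by
  have h1 : ∀ᵐ x ∂μ, x ∈ Ω ∧ tauMinus F Ω x < 1 → p (entryPoint F Ω x) := by
    -- The term `n = 0` of the supremum already controls all points with `τ₋ < 1`.
    have hle : (μ.restrict {x | x ∈ Ω ∧ tauMinus F Ω x < 1}).map (entryPoint F Ω)
        ≤ incomingMeasure F Ω μ := by
      have := le_iSup (fun n : ℕ => ((n : ℝ≥0∞) + 1) •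
        (μ.restrict {x | x ∈ Ω ∧ tauMinus F Ω x < ((n : ℝ≥0∞) + 1)⁻¹}).map
          (entryPoint F Ω)) 0
      simpa [incomingMeasure] using this
    have h := ae_of_ae_map (aemeasurable_entryPoint hF hΩ 1) (ae_mono hle hp)
    exact (ae_restrict_iff' (measurableSet_tauMinus_lt hF hΩ 1)).1 h
  -- A point with larger `τ₋` is moved back by a rational time in `(τ₋ - 1, τ₋)`, which preserves
  -- its entry point. Rational times keep the union of exceptional sets null.
  filter_upwards [ae_all_iff.2 fun q : ℚ => ae_comp_flow hF hμ h1 (-(q : ℝ))] with x hx hxΩ hτ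
  obtain ⟨q, hq, hq'⟩ := exists_rat_btwn
    (max_lt (tauMinus_toReal_pos hF hΩ hxΩ hτ) (sub_one_lt (tauMinus F Ω x).toReal))
  have hq0 : (0 : ℝ) ≤ q := (le_max_left _ _).trans hq.le
  have hD := (lt_tauMinus_toReal_iff hF hΩ hxΩ hτ hq0).1 hq'
  have := hx q ⟨flow_mem_of_mem_stayDomain hD, ?_⟩
  · rwa [entryPoint_flow_neg hF hΩ hτ hq0 hD] at this
  · rw [tauMinus_flow_neg hF hΩ hq0 hD, ← ENNReal.ofReal_toReal hτ.ne,
      ← ENNReal.ofReal_sub _ hq0, ← ENNReal.ofReal_one]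
    refine (ENNReal.ofReal_lt_ofReal_iff one_pos).2 ?_
    linarith [(le_max_right 0 ((tauMinus F Ω x).toReal - 1)).trans_lt hq]

/-- A measurable set of boundary points which almost no characteristic enters through is null. -/
lemma ae_incomingMeasure_of_ae_entryPoint (hF : LipschitzWith κ F)
    (hΩ : IsOpen Ω) {W : Set (Phase N)} (hW : MeasurableSet W)
    (h : ∀ᵐ x ∂μ, x ∈ Ω → tauMinus F Ω x < ∞ → entryPoint F Ω x ∉ W) :
    ∀ᵐ y ∂(incomingMeasure F Ω μ), y ∉ W := by
  -- For null sets the supremum of measures may be replaced by their sum, which is handled term by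
  -- term.
  refine ae_mono (iSup_le fun n => Measure.le_sum _ n) (Measure.ae_sum_iff.2 fun n => ?_)
  refine Measure.ae_smul_measure ?_ _
  rw [ae_map_iff (aemeasurable_entryPoint hF hΩ _) hW.compl]
  filter_upwards [ae_restrict_of_ae h,
    ae_restrict_mem (measurableSet_tauMinus_lt hF hΩ ((n : ℝ≥0∞) + 1)⁻¹)] with x hx hxn
  exact hx hxn.1 (hxn.2.trans_le le_top)

/-- A property of almost every point of `Ω` holds somewhere along the characteristic issued from
almost every point of `Γ₋`. -/
lemma ae_incomingMeasure_exists [IsFiniteMeasureOnCompacts μ] (hF : LipschitzWith κ F)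
    (hμ : FlowInvariant F μ) (hΩ : IsOpen Ω) {p : Phase N → Prop}
    (hp : ∀ᵐ x ∂μ, x ∈ Ω → p x) :
    ∀ᵐ y ∂(incomingMeasure F Ω μ), y ∈ incomingBoundary F Ω →
      ∃ x ∈ Ω, tauMinus F Ω x < ∞ ∧ p x ∧ entryPoint F Ω x = y := by
  obtain ⟨Z, hZ, hZm, hZ0⟩ := exists_measurable_superset_of_null (ae_iff.1 hp)
  -- Boundary points whose characteristic lies in `Z` for almost all times in `(0, 1/(n+1))`. The
  -- condition "almost all", unlike "all", gives a measurable set by Fubini.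
  set B : ℕ → Set (Phase N) := fun n => {y | volume.restrict (Ioo (0 : ℝ) (1 / (n + 1)))
    (Prod.mk y ⁻¹' {p : Phase N × ℝ | flow F p.1 p.2 ∉ Z}) = 0}
  have hpm : MeasurableSet {p : Phase N × ℝ | flow F p.1 p.2 ∉ Z} :=
    (measurable_flow hF) hZm.compl
  have hBm : ∀ n, MeasurableSet (B n) := fun n =>
    (measurable_measure_prodMk_left hpm) (measurableSet_singleton 0)
  have hBn : ∀ n, ∀ᵐ y ∂(incomingMeasure F Ω μ), y ∉ B n := fun n => by
    refine ae_incomingMeasure_of_ae_entryPoint hF hΩ (hBm n) ?_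
    filter_upwards [ae_ae_comp_flow hF hμ (p := fun x => x ∉ Z)
      (compl_mem_ae_iff.2 hZ0)] with x hx _ _ hxB
    have hx' : ∀ᵐ t : ℝ, flow F (entryPoint F Ω x) t ∉ Z := by
      have := (measurePreserving_add_left volume
        (-(tauMinus F Ω x).toReal)).quasiMeasurePreserving.ae hx
      filter_upwards [this] with t ht
      rwa [entryPoint, flow_flow hF]
    have h0 : volume.restrict (Ioo (0 : ℝ) (1 / (n + 1)))
        {t | flow F (entryPoint F Ω x) t ∉ Z}ᶜ = 0 := ae_restrict_of_ae hx'
    have huniv := measure_union_null h0 hxB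
    have : {t | flow F (entryPoint F Ω x) t ∉ Z}ᶜ ∪ Prod.mk (entryPoint F Ω x) ⁻¹'
        {p : Phase N × ℝ | flow F p.1 p.2 ∉ Z} = univ := compl_union_self _
    rw [this, Measure.restrict_apply_univ, Real.volume_Ioo, ENNReal.ofReal_eq_zero] at huniv
    have : (0 : ℝ) < 1 / (n + 1) := Nat.one_div_pos_of_nat
    linarith
  filter_upwards [ae_all_iff.2 hBn] with y hy hyΓ
  by_contra hc
  obtain ⟨-, x, hx, hτ, rfl⟩ := hyΓ
  have hpos := tauMinus_toReal_pos hF hΩ hx hτ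
  obtain ⟨n, hn⟩ := exists_nat_one_div_lt hpos
  -- If no good point exists on the characteristic from `y`, every point of it in `Ω` belongs to
  -- `Z`, and it remains in `Ω` during `(0, 1/(n+1))`; thus `y ∈ B n`, a contradiction.
  refine hy n ?_
  change volume.restrict (Ioo (0 : ℝ) (1 / (n + 1))) _ = 0
  rw [Measure.restrict_apply (measurable_prodMk_left hpm)]
  refine measure_mono_null (t := ∅) (fun t ht => ?_) measure_empty
  have hle : 0 ≤ (tauMinus F Ω x).toReal - t := by linarith [ht.2.2]
  have hD := (lt_tauMinus_toReal_iff hF hΩ hx hτ hle).1 (by linarith [ht.2.1])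
  refine ht.1 (hZ ?_)
  change ¬ (flow F (entryPoint F Ω x) t ∈ Ω → p (flow F (entryPoint F Ω x) t))
  rw [flow_entryPoint hF]
  refine fun hp' => hc ⟨_, flow_mem_of_mem_stayDomain hD, ?_,
    hp' (flow_mem_of_mem_stayDomain hD), entryPoint_flow_neg hF hΩ hτ hle hD⟩
  rw [tauMinus_flow_neg hF hΩ hle hD]
  exact tsub_le_self.trans_lt hτ

lemma IsRegularPoint.tendsto_entryPoint (hF : LipschitzWith κ F) (hΩ : IsOpen Ω)
    {f g : L1Space Ω μ} {x : Phase N} (h : IsRegularPoint F f g x)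
    (hτ : tauMinus F Ω x < ∞) :
    Tendsto (fun t => charMean F (zeroExt Ω f) (flow F (entryPoint F Ω x) t)) (𝓝[>] 0)
      (𝓝 (zeroExt Ω f x
        - ∫ s in (0 : ℝ)..(-(tauMinus F Ω x).toReal), zeroExt Ω g (flow F x s))) := by
  have hc := (h.continuous_primitive.comp (by fun_prop :
    Continuous fun t : ℝ => -((tauMinus F Ω x).toReal - t))).tendsto 0
  simp only [Function.comp_apply, sub_zero] at hc
  refine (hc.mono_left nhdsWithin_le_nhds).congr' ?_
  filter_upwards [Ioo_mem_nhdsGT (tauMinus_toReal_pos hF hΩ h.mem hτ)] with t ht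
  rw [flow_entryPoint hF, h.charMean_flow hF hΩ]
  · rfl
  · exact (lt_tauMinus_toReal_iff hF hΩ h.mem hτ (by linarith [ht.2])).1 (by linarith [ht.1])

/-- If two functions agree in `Ω` along the characteristic through `x`, they have the same
limits at the entry point of `x`. -/
lemma tendsto_entryPoint_congr (hF : LipschitzWith κ F) (hΩ : IsOpen Ω) {fs fs' : Phase N → ℝ}
    {x : Phase N} (hx : x ∈ Ω) (hτ : tauMinus F Ω x < ∞)
    (h : ∀ t, (x, t) ∈ stayDomain F Ω → fs' (flow F x t) = fs (flow F x t)) {b : ℝ}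
    (hb : Tendsto (fun t => fs' (flow F (entryPoint F Ω x) t)) (𝓝[>] 0) (𝓝 b)) :
    Tendsto (fun t => fs (flow F (entryPoint F Ω x) t)) (𝓝[>] 0) (𝓝 b) := by
  refine hb.congr' ?_
  filter_upwards [Ioo_mem_nhdsGT (tauMinus_toReal_pos hF hΩ hx hτ)] with t ht
  rw [flow_entryPoint hF]
  exact h _ ((lt_tauMinus_toReal_iff hF hΩ hx hτ (by linarith [ht.2])).1 (by linarith [ht.1]))

/-- Existence of the incoming trace, with the formula along the characteristics. -/
lemma isIncomingTrace_of_maxTransport [IsFiniteMeasureOnCompacts μ] (hF : LipschitzWith κ F)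
    (hμ : FlowInvariant F μ) (hΩ : IsOpen Ω) {f g : L1Space Ω μ}
    (hfg : (f, g) ∈ maxTransport F Ω μ) {b : Phase N → ℝ}
    (hb : ∀ᵐ x ∂μ, x ∈ Ω → tauMinus F Ω x < ∞ → b (entryPoint F Ω x) = zeroExt Ω f x
        - ∫ s in (0 : ℝ)..(-(tauMinus F Ω x).toReal), zeroExt Ω g (flow F x s)) :
    IsIncomingTrace F Ω μ f b := by
  refine ⟨g, charMean F (zeroExt Ω f), isMildRepresentative_charMean hF hμ hΩ hfg, ?_⟩
  have h : ∀ᵐ x ∂μ, x ∈ Ω → IsRegularPoint F f g x ∧ (tauMinus F Ω x < ∞ →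
      b (entryPoint F Ω x) = zeroExt Ω f x
        - ∫ s in (0 : ℝ)..(-(tauMinus F Ω x).toReal), zeroExt Ω g (flow F x s)) := by
    filter_upwards [ae_isRegularPoint hF hμ hΩ hfg, hb] with x h1 h2 hx
    exact ⟨h1 hx, h2 hx⟩
  filter_upwards [ae_incomingMeasure_exists hF hμ hΩ h] with y hy hyΓ
  obtain ⟨x, -, hτ, ⟨hreg, hbx⟩, rfl⟩ := hy hyΓ
  rw [hbx hτ]
  exact hreg.tendsto_entryPoint hF hΩ hτ

lemma exists_isIncomingTrace [IsFiniteMeasureOnCompacts μ] (hF : LipschitzWith κ F)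
    (hμ : FlowInvariant F μ) (hΩ : IsOpen Ω) {f g : L1Space Ω μ}
    (hfg : (f, g) ∈ maxTransport F Ω μ) : ∃ b : Phase N → ℝ, IsIncomingTrace F Ω μ f b := by
  refine ⟨fun y => limUnder (𝓝[>] 0) fun t => charMean F (zeroExt Ω f) (flow F y t),
    isIncomingTrace_of_maxTransport hF hμ hΩ hfg ?_⟩
  filter_upwards [ae_isRegularPoint hF hμ hΩ hfg] with x h hx hτ
  exact ((h hx).tendsto_entryPoint hF hΩ hτ).limUnder_eq

/-- Two admissible representatives coincide along almost every characteristic, and almost every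
boundary point issues such a characteristic, so the two limits are limits of the same function. -/
lemma IsIncomingTrace.ae_eq [IsFiniteMeasureOnCompacts μ] (hF : LipschitzWith κ F)
    (hμ : FlowInvariant F μ) (hΩ : IsOpen Ω) {f : L1Space Ω μ} {b b' : Phase N → ℝ}
    (h : IsIncomingTrace F Ω μ f b) (h' : IsIncomingTrace F Ω μ f b') :
    ∀ᵐ y ∂(incomingMeasure F Ω μ), y ∈ incomingBoundary F Ω → b' y = b y := by
  obtain ⟨g, fs, hfs, hlim⟩ := h
  obtain ⟨g', fs', hfs', hlim'⟩ := h'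
  filter_upwards [ae_incomingMeasure_exists hF hμ hΩ (hfs.ae_eq_along hF hμ hΩ hfs'),
    hlim, hlim'] with y hy h1 h2 hyΓ
  obtain ⟨x, hx, hτ, hag, rfl⟩ := hy hyΓ
  exact tendsto_nhds_unique (tendsto_entryPoint_congr hF hΩ hx hτ hag (h2 hyΓ)) (h1 hyΓ)

/-- A function with zero incoming trace vanishes at the entry of almost every characteristic. -/
lemma ae_entry_value_eq_zero [IsFiniteMeasureOnCompacts μ] (hF : LipschitzWith κ F)
    (hμ : FlowInvariant F μ) (hΩ : IsOpen Ω) {f g : L1Space Ω μ}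
    (hfg : (f, g) ∈ zeroInflowTransport F Ω μ) :
    ∀ᵐ x ∂μ, x ∈ Ω → tauMinus F Ω x < ∞ → zeroExt Ω f x
        - ∫ s in (0 : ℝ)..(-(tauMinus F Ω x).toReal), zeroExt Ω g (flow F x s) = 0 := by
  obtain ⟨hmax, g', fs', hfs', hlim⟩ := hfg
  filter_upwards [ae_entryPoint_of_ae_incomingMeasure hF hμ hΩ hlim,
    (isMildRepresentative_charMean hF hμ hΩ hmax).ae_eq_along hF hμ hΩ hfs',
    ae_isRegularPoint hF hμ hΩ hmax] with x h1 h2 h3 hx hτ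
  exact tendsto_nhds_unique ((h3 hx).tendsto_entryPoint hF hΩ hτ)
    (tendsto_entryPoint_congr hF hΩ hx hτ (h2 hx)
      (h1 hx hτ (entryPoint_mem_incomingBoundary hF hΩ hx hτ)))

/-! ### Contraction semigroups: the generator through the integral identity -/

section Semigroup

variable {E : Type*} [NormedAddCommGroup E] [NormedSpace ℝ E] {U : ℝ≥0 → E →L[ℝ] E}

lemma IsC0Semigroup.norm_sub_le (hU : IsC0Semigroup U) (hc : ∀ t, ‖U t‖ ≤ 1) (f : E)
    (s t : ℝ≥0) : ‖U s f - U t f‖ ≤ ‖U (nndist s t) f - f‖ := by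
  wlog h : t ≤ s generalizing s t
  · rw [norm_sub_rev, nndist_comm]
    exact this t s (not_le.1 h).le
  have hd : nndist s t = s - t := by
    rw [NNReal.nndist_eq, tsub_eq_zero_of_le h, max_eq_left zero_le]
  have : U s f - U t f = U t (U (s - t) f - f) := by
    rw [map_sub, ← ContinuousLinearMap.comp_apply, ← hU.map_add, add_tsub_cancel_of_le h]
  rw [this, hd]
  exact ((U t).le_opNorm _).trans (mul_le_of_le_one_left (norm_nonneg _) (hc t))

lemma IsC0Semigroup.continuous_orbit (hU : IsC0Semigroup U) (hc : ∀ t, ‖U t‖ ≤ 1) (f : E) :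
    Continuous fun t => U t f := by
  have h0 : Tendsto (fun t => ‖U t f - f‖) (𝓝 0) (𝓝 0) := by
    have h1 : ContinuousWithinAt (fun t => U t f) (Ioi 0) 0 := by
      simpa [ContinuousWithinAt, hU.map_zero] using hU.tendsto_zero f
    have h2 := continuousWithinAt_Ioi_iff_Ici.1 h1
    have : Ici (0 : ℝ≥0) = univ := Ici_bot
    rw [this, continuousWithinAt_univ] at h2
    have h3 := (h2.tendsto.sub_const f).norm
    simpa [hU.map_zero] using h3
  rw [continuous_iff_continuousAt]
  intro t
  rw [ContinuousAt, tendsto_iff_norm_sub_tendsto_zero]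
  have hd : Tendsto (fun s => nndist s t) (𝓝 t) (𝓝 0) := by
    have : Continuous fun s => nndist s t := by fun_prop
    simpa using this.tendsto t
  exact squeeze_zero (fun _ => norm_nonneg _) (fun s => hU.norm_sub_le hc f s t) (h0.comp hd)

lemma IsC0Semigroup.continuous_orbit_real (hU : IsC0Semigroup U) (hc : ∀ t, ‖U t‖ ≤ 1)
    (f : E) : Continuous fun t : ℝ => U t.toNNReal f :=
  (hU.continuous_orbit hc f).comp continuous_real_toNNReal

variable [CompleteSpace E]

/-- The definition of the generator only gives right derivatives of the orbit; with continuity of `s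
↦ U(s)f` and `s ↦ U(s)g` this suffices for the fundamental theorem of calculus. -/
lemma IsC0Semigroup.sub_eq_integral (hU : IsC0Semigroup U) (hc : ∀ t, ‖U t‖ ≤ 1) {f g : E}
    (hfg : (f, g) ∈ generatorGraph U) (t : ℝ≥0) :
    U t f - f = ∫ s in (0 : ℝ)..t, U s.toNNReal g := by
  have hf := hU.continuous_orbit_real hc f
  have hg := hU.continuous_orbit_real hc g
  have h := intervalIntegral.integral_eq_sub_of_hasDeriv_right (a := 0) (b := (t : ℝ))
    (f := fun s : ℝ => U s.toNNReal f) (f' := fun s : ℝ => U s.toNNReal g) hf.continuousOn ?_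
    (hg.intervalIntegrable _ _)
  · rw [h]
    simp [hU.map_zero]
  · intro s hs
    have hs0 : 0 ≤ s := by
      rw [min_eq_left t.coe_nonneg] at hs
      exact hs.1.le
    rw [hasDerivWithinAt_iff_tendsto_slope' self_notMem_Ioi]
    have hr : Tendsto (fun r : ℝ => (r - s).toNNReal) (𝓝[>] s) (𝓝[>] 0) := by
      refine tendsto_nhdsWithin_iff.2 ⟨?_, ?_⟩
      · have : Continuous fun r : ℝ => (r - s).toNNReal := by fun_prop
        have := this.tendsto s
        simp only [sub_self, Real.toNNReal_zero] at this
        exact this.mono_left nhdsWithin_le_nhds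
      · filter_upwards [self_mem_nhdsWithin] with r hr
        exact Real.toNNReal_pos.2 (sub_pos.2 hr)
    have hlim : Tendsto (fun h : ℝ≥0 => ((h : ℝ)⁻¹) • (U h f - f)) (𝓝[>] 0) (𝓝 g) := hfg
    refine (((U s.toNNReal).continuous.tendsto g).comp (hlim.comp hr)).congr' ?_
    filter_upwards [self_mem_nhdsWithin] with r hr
    have hrs : s < r := hr
    simp only [Function.comp_apply, slope_def_module, map_smul, map_sub]
    rw [Real.coe_toNNReal _ (sub_nonneg.2 hrs.le), ← ContinuousLinearMap.comp_apply,
      ← hU.map_add, ← Real.toNNReal_add hs0 (sub_nonneg.2 hrs.le), add_sub_cancel]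

/-- The difference quotients are averages over `[0,t]` of an orbit that is continuous at `0`, with
value `g` there. -/
lemma IsC0Semigroup.mem_generatorGraph (hU : IsC0Semigroup U) (hc : ∀ t, ‖U t‖ ≤ 1) {f g : E}
    (h : ∀ t : ℝ≥0, U t f - f = ∫ s in (0 : ℝ)..t, U s.toNNReal g) :
    (f, g) ∈ generatorGraph U := by
  have hd := hasDerivAt_iff_tendsto_slope_zero.1
    ((hU.continuous_orbit_real hc g).integral_hasStrictDerivAt 0 0).hasDerivAt
  have ht : Tendsto (fun t : ℝ≥0 => (t : ℝ)) (𝓝[>] 0) (𝓝[≠] 0) := by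
    refine tendsto_nhdsWithin_iff.2 ⟨?_, ?_⟩
    · exact (NNReal.continuous_coe.tendsto' 0 0 rfl).mono_left nhdsWithin_le_nhds
    · filter_upwards [self_mem_nhdsWithin] with t ht
      exact (NNReal.coe_pos.2 ht).ne'
  have := hd.comp ht
  simp only [Real.toNNReal_zero, hU.map_zero, ContinuousLinearMap.id_apply, zero_add,
    intervalIntegral.integral_same, sub_zero] at this
  refine this.congr fun t => ?_
  simp only [Function.comp_apply, h t]

end Semigroup

/-! ### The transport semigroup -/

/-- The transport of `h` along the characteristics during the time `t`, with zero inflow. -/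
def transport (F : Phase N → Phase N) (Ω : Set (Phase N)) (t : ℝ) (h : Phase N → ℝ) :
    Phase N → ℝ :=
  {x | (x, -t) ∈ stayDomain F Ω}.indicator fun x => h (flow F x (-t))

lemma transport_of_mem {t : ℝ} {h : Phase N → ℝ} {x : Phase N}
    (hx : (x, -t) ∈ stayDomain F Ω) : transport F Ω t h x = h (flow F x (-t)) :=
  indicator_of_mem (s := {x | (x, -t) ∈ stayDomain F Ω}) hx _

lemma transport_of_notMem {t : ℝ} {h : Phase N → ℝ} {x : Phase N}
    (hx : (x, -t) ∉ stayDomain F Ω) : transport F Ω t h x = 0 :=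
  indicator_of_notMem (s := {x | (x, -t) ∈ stayDomain F Ω}) hx _

lemma transport_eq_zero_of_notMem (hF : LipschitzWith κ F) (t : ℝ) (h : Phase N → ℝ)
    {x : Phase N} (hx : x ∉ Ω) : transport F Ω t h x = 0 :=
  transport_of_notMem fun hD => hx (mem_of_mem_stayDomain hF hD)

lemma norm_transport_le (t : ℝ) (h : Phase N → ℝ) (x : Phase N) :
    ‖transport F Ω t h x‖ ≤ ‖h (flow F x (-t))‖ := norm_indicator_le_norm_self _ _

lemma stronglyMeasurable_transport (hF : LipschitzWith κ F) (hΩ : IsOpen Ω)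
    {h : Phase N → ℝ} (hm : StronglyMeasurable h) :
    StronglyMeasurable fun p : Phase N × ℝ => transport F Ω p.2 h p.1 := by
  have hθ : Continuous fun p : Phase N × ℝ => (p.1, -p.2) := by fun_prop
  exact (hm.comp_measurable ((measurable_flow hF).comp hθ.measurable)).indicator
    ((isOpen_stayDomain hF hΩ).preimage hθ).measurableSet

lemma integrable_transport (hF : LipschitzWith κ F) (hμ : FlowInvariant F μ) (hΩ : IsOpen Ω)
    {h : Phase N → ℝ} (hh : Integrable h μ) (t : ℝ) : Integrable (transport F Ω t h) μ :=
  (integrable_comp_flow hF hμ hh (-t)).indicator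
    ((isOpen_stayDomain hF hΩ).preimage
      (by fun_prop : Continuous fun x : Phase N => (x, -t))).measurableSet

lemma integrable_transport_prod [IsFiniteMeasureOnCompacts μ] (hF : LipschitzWith κ F)
    (hμ : FlowInvariant F μ) (hΩ : IsOpen Ω) {h : Phase N → ℝ} (hm : StronglyMeasurable h)
    (hh : Integrable h μ) (ν : Measure ℝ) [IsFiniteMeasure ν] :
    Integrable (fun p : Phase N × ℝ => transport F Ω p.2 h p.1) (μ.prod ν) :=
  (integrable_comp_flow_prod hF hμ hm hh ν measurable_neg).mono
    (stronglyMeasurable_transport hF hΩ hm).aestronglyMeasurable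
    (Eventually.of_forall fun _ => norm_transport_le _ _ _)

lemma transport_transport (hF : LipschitzWith κ F) {s t : ℝ} (hs : 0 ≤ s) (ht : 0 ≤ t)
    (h : Phase N → ℝ) : transport F Ω s (transport F Ω t h) = transport F Ω (s + t) h := by
  funext x
  by_cases h1 : (x, -s) ∈ stayDomain F Ω
  · rw [transport_of_mem h1]
    by_cases h2 : (flow F x (-s), -t) ∈ stayDomain F Ω
    · rw [transport_of_mem h2, transport_of_mem, flow_flow hF, neg_add]
      rwa [neg_add, ← flow_mem_stayDomain_iff hF h1]
    · rw [transport_of_notMem h2, transport_of_notMem]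
      rwa [neg_add, ← flow_mem_stayDomain_iff hF h1]
  · rw [transport_of_notMem h1, transport_of_notMem]
    refine fun h' => h1 (stayDomain_mono h' ?_)
    rw [uIcc_of_ge (by linarith)]
    exact ⟨by linarith, by linarith⟩

lemma ae_transport_congr (hF : LipschitzWith κ F) (hμ : FlowInvariant F μ) {h h' : Phase N → ℝ}
    (hh : h =ᵐ[μ] h') (t : ℝ) : transport F Ω t h =ᵐ[μ] transport F Ω t h' := by
  filter_upwards [ae_comp_flow hF hμ hh (-t)] with x hx
  simp only [transport, indicator, hx]

lemma zeroExt_ae_eq (hΩ : IsOpen Ω) {f : L1Space Ω μ} {h : Phase N → ℝ}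
    (hf : f =ᵐ[μ.restrict Ω] h) : zeroExt Ω f =ᵐ[μ] Ω.indicator h := by
  filter_upwards [(ae_restrict_iff' hΩ.measurableSet).1 hf] with x hx
  by_cases hxΩ : x ∈ Ω
  · rw [zeroExt_of_mem f hxΩ, indicator_of_mem hxΩ, hx hxΩ]
  · rw [zeroExt, indicator_of_notMem hxΩ, indicator_of_notMem hxΩ]

lemma zeroExt_ae_eq_self (hΩ : IsOpen Ω) (f : L1Space Ω μ) :
    zeroExt Ω f =ᵐ[μ.restrict Ω] f := by
  filter_upwards [ae_restrict_mem hΩ.measurableSet] with x hx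
  exact zeroExt_of_mem f hx

lemma eq_of_zeroExt_ae_eq (hΩ : IsOpen Ω) {f g : L1Space Ω μ}
    (h : zeroExt Ω f =ᵐ[μ] zeroExt Ω g) : f = g :=
  Lp.ext ((zeroExt_ae_eq_self hΩ f).symm.trans
    (EventuallyEq.trans (ae_restrict_of_ae h) (zeroExt_ae_eq_self hΩ g)))

lemma zeroExt_add (hΩ : IsOpen Ω) (f g : L1Space Ω μ) :
    zeroExt Ω (f + g) =ᵐ[μ] fun x => zeroExt Ω f x + zeroExt Ω g x :=
  (zeroExt_ae_eq hΩ (Lp.coeFn_add f g)).trans (Eventually.of_forall fun x =>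
    congrFun (indicator_add Ω (f : Phase N → ℝ) g) x)

lemma zeroExt_smul (hΩ : IsOpen Ω) (c : ℝ) (f : L1Space Ω μ) :
    zeroExt Ω (c • f) =ᵐ[μ] fun x => c • zeroExt Ω f x :=
  (zeroExt_ae_eq hΩ (Lp.coeFn_smul c f)).trans (Eventually.of_forall fun x =>
    congrFun (indicator_const_smul Ω c (f : Phase N → ℝ)) x)

lemma zeroExt_sub (hΩ : IsOpen Ω) (f g : L1Space Ω μ) :
    zeroExt Ω (f - g) =ᵐ[μ] fun x => zeroExt Ω f x - zeroExt Ω g x :=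
  (zeroExt_ae_eq hΩ (Lp.coeFn_sub f g)).trans (Eventually.of_forall fun x =>
    congrFun (indicator_sub Ω (f : Phase N → ℝ) g) x)

lemma norm_eq_integral_zeroExt (hΩ : IsOpen Ω) (f : L1Space Ω μ) :
    ‖f‖ = ∫ x, ‖zeroExt Ω f x‖ ∂μ := by
  rw [L1.norm_eq_integral_norm, ← integral_indicator hΩ.measurableSet]
  simp only [zeroExt, norm_indicator_eq_indicator_norm]

/-- The transport semigroup with zero inflow on `L¹(Ω, μ)`, as a linear map. -/
def transportLinear (hF : LipschitzWith κ F) (hμ : FlowInvariant F μ) (hΩ : IsOpen Ω) (t : ℝ) :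
    L1Space Ω μ →ₗ[ℝ] L1Space Ω μ where
  toFun f := (integrable_transport hF hμ hΩ (integrable_zeroExt hΩ f) t).restrict.toL1 _
  map_add' f g := by
    rw [← Integrable.toL1_add]
    refine (Integrable.toL1_eq_toL1_iff _ _ _ _).2 (ae_restrict_of_ae ?_)
    refine (ae_transport_congr hF hμ (zeroExt_add hΩ f g) t).trans (Eventually.of_forall fun x => ?_)
    exact congrFun (indicator_add _ _ _) x
  map_smul' c f := by
    rw [RingHom.id_apply, ← Integrable.toL1_smul]
    refine (Integrable.toL1_eq_toL1_iff _ _ _ _).2 (ae_restrict_of_ae ?_)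
    refine (ae_transport_congr hF hμ (zeroExt_smul hΩ c f) t).trans (Eventually.of_forall fun x => ?_)
    exact congrFun (indicator_const_smul _ c _) x

lemma transportLinear_ae_eq (hF : LipschitzWith κ F) (hμ : FlowInvariant F μ) (hΩ : IsOpen Ω)
    (t : ℝ) (f : L1Space Ω μ) :
    transportLinear hF hμ hΩ t f =ᵐ[μ.restrict Ω] transport F Ω t (zeroExt Ω f) :=
  Integrable.coeFn_toL1 (integrable_transport hF hμ hΩ (integrable_zeroExt hΩ f) t).restrict

lemma zeroExt_transportLinear (hF : LipschitzWith κ F) (hμ : FlowInvariant F μ) (hΩ : IsOpen Ω)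
    (t : ℝ) (f : L1Space Ω μ) :
    zeroExt Ω (transportLinear hF hμ hΩ t f) =ᵐ[μ] transport F Ω t (zeroExt Ω f) := by
  refine (zeroExt_ae_eq hΩ (transportLinear_ae_eq hF hμ hΩ t f)).trans
    (Eventually.of_forall fun x => ?_)
  by_cases hx : x ∈ Ω
  · exact indicator_of_mem hx _
  · rw [indicator_of_notMem hx, transport_eq_zero_of_notMem hF _ _ hx]

lemma norm_transportLinear_le (hF : LipschitzWith κ F) (hμ : FlowInvariant F μ) (hΩ : IsOpen Ω)
    (t : ℝ) (f : L1Space Ω μ) : ‖transportLinear hF hμ hΩ t f‖ ≤ 1 * ‖f‖ := by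
  have hf := integrable_zeroExt hΩ f
  rw [one_mul, norm_eq_integral_zeroExt hΩ, norm_eq_integral_zeroExt hΩ f,
    ← integral_comp_flow hF hμ (fun x => ‖zeroExt Ω f x‖) (-t),
    integral_congr_ae (g := fun x => ‖transport F Ω t (zeroExt Ω f) x‖)
      (by exact (zeroExt_transportLinear hF hμ hΩ t f).fun_comp norm)]
  exact integral_mono (integrable_transport hF hμ hΩ hf t).norm
    (integrable_comp_flow hF hμ hf (-t)).norm fun x => norm_transport_le _ _ _

/-- The transport semigroup with zero inflow on `L¹(Ω, μ)`. -/
def transportSemigroup (hF : LipschitzWith κ F) (hμ : FlowInvariant F μ) (hΩ : IsOpen Ω)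
    (t : ℝ≥0) : L1Space Ω μ →L[ℝ] L1Space Ω μ :=
  (transportLinear hF hμ hΩ t).mkContinuous 1 (norm_transportLinear_le hF hμ hΩ t)

lemma norm_transportSemigroup_le (hF : LipschitzWith κ F) (hμ : FlowInvariant F μ)
    (hΩ : IsOpen Ω) (t : ℝ≥0) : ‖transportSemigroup hF hμ hΩ t‖ ≤ 1 :=
  LinearMap.mkContinuous_norm_le _ zero_le_one _

lemma zeroExt_transportSemigroup (hF : LipschitzWith κ F) (hμ : FlowInvariant F μ)
    (hΩ : IsOpen Ω) (t : ℝ≥0) (f : L1Space Ω μ) :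
    zeroExt Ω (transportSemigroup hF hμ hΩ t f) =ᵐ[μ] transport F Ω t (zeroExt Ω f) :=
  zeroExt_transportLinear hF hμ hΩ t f

lemma transportSemigroup_apply_ae (hF : LipschitzWith κ F) (hμ : FlowInvariant F μ)
    (hΩ : IsOpen Ω) (t : ℝ≥0) (f : L1Space Ω μ) :
    ∀ᵐ x ∂(μ.restrict Ω), transportSemigroup hF hμ hΩ t f x =
      {z | (t : ℝ≥0∞) < tauMinus F Ω z}.indicator (fun z => f (flow F z (-(t : ℝ)))) x := by
  filter_upwards [transportLinear_ae_eq hF hμ hΩ t f, ae_restrict_mem hΩ.measurableSet]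
    with x hx hxΩ
  have hiff := ofReal_lt_tauMinus_iff hF hΩ hxΩ t.coe_nonneg
  rw [ENNReal.ofReal_coe_nnreal] at hiff
  refine hx.trans ?_
  by_cases hD : (x, -(t : ℝ)) ∈ stayDomain F Ω
  · rw [transport_of_mem hD, zeroExt_of_mem f (flow_mem_of_mem_stayDomain hD),
      indicator_of_mem (by exact hiff.2 hD)]
  · rw [transport_of_notMem hD, indicator_of_notMem (by exact fun h => hD (hiff.1 h))]

lemma transportSemigroup_nonneg (hF : LipschitzWith κ F) (hμ : FlowInvariant F μ)
    (hΩ : IsOpen Ω) (t : ℝ≥0) {f : L1Space Ω μ} (hf : 0 ≤ f) :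
    0 ≤ transportSemigroup hF hμ hΩ t f := by
  rw [← Lp.coeFn_nonneg] at hf ⊢
  have hz : ∀ᵐ x ∂μ, 0 ≤ zeroExt Ω f x := by
    filter_upwards [(ae_restrict_iff' hΩ.measurableSet).1 hf] with x hx
    exact indicator_apply_nonneg fun h => hx h
  filter_upwards [transportLinear_ae_eq hF hμ hΩ t f,
    ae_restrict_of_ae (ae_comp_flow hF hμ hz (-(t : ℝ)))] with x hx h0
  refine le_of_le_of_eq ?_ hx.symm
  exact indicator_apply_nonneg fun _ => h0

/-- For `t < 1` the integrand lives on the compact flow image of `tsupport φ × [0,1]`, which has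
finite measure and gives a constant dominating function. Pointwise, each `x ∈ Ω` stays in `Ω` for
short backward times, so the cut-off disappears in the limit even though `φ` need not vanish near
`∂Ω`. -/
lemma tendsto_transport_of_hasCompactSupport [IsFiniteMeasureOnCompacts μ]
    (hF : LipschitzWith κ F) (hΩ : IsOpen Ω) {φ : Phase N → ℝ}
    (hφ : Continuous φ) (hc : HasCompactSupport φ) :
    Tendsto (fun t : ℝ≥0 => ∫ x in Ω, ‖transport F Ω t (Ω.indicator φ) x - φ x‖ ∂μ)
      (𝓝[>] 0) (𝓝 0) := by
  obtain ⟨C, hC⟩ := hφ.bounded_above_of_compact_support hc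
  set K := (fun p : Phase N × ℝ => flow F p.1 p.2) '' (tsupport φ ×ˢ Icc 0 1)
  have hKc : IsCompact K := (hc.isCompact.prod isCompact_Icc).image (continuous_flow hF)
  have hmem : ∀ (x : Phase N) (s : ℝ), s ∈ Icc (0 : ℝ) 1 → φ (flow F x (-s)) ≠ 0 → x ∈ K :=
    fun x s hs h => ⟨(flow F x (-s), s), ⟨subset_tsupport _ h, hs⟩, flow_flow_neg hF x s⟩
  have h0 : ∫ x in Ω, (0 : ℝ) ∂μ = 0 := integral_zero _ _
  rw [← h0]
  refine tendsto_integral_filter_of_dominated_convergence (K.indicator fun _ => C + C)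
    (Eventually.of_forall fun t => ?_) ?_ ?_ ?_
  · have hm : StronglyMeasurable (Ω.indicator φ) :=
      hφ.stronglyMeasurable.indicator hΩ.measurableSet
    exact ((((stronglyMeasurable_transport hF hΩ hm).comp_measurable
      (measurable_id.prodMk measurable_const)).sub hφ.stronglyMeasurable).norm).aestronglyMeasurable
  · have h1 : ∀ᶠ t : ℝ≥0 in 𝓝[>] 0, t < 1 :=
      nhdsWithin_le_nhds (Iio_mem_nhds zero_lt_one)
    filter_upwards [h1] with t ht
    refine Eventually.of_forall fun x => ?_
    rw [norm_norm]
    have ht' : (t : ℝ) ∈ Icc (0 : ℝ) 1 := ⟨t.coe_nonneg, by exact_mod_cast ht.le⟩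
    have hle : ‖transport F Ω t (Ω.indicator φ) x‖ ≤ ‖φ (flow F x (-t))‖ :=
      (norm_transport_le _ _ _).trans (norm_indicator_le_norm_self _ _)
    by_cases hx : x ∈ K
    · rw [indicator_of_mem hx]
      exact (norm_sub_le _ _).trans (add_le_add (hle.trans (hC _)) (hC _))
    · rw [indicator_of_notMem hx]
      have e1 : φ (flow F x (-t)) = 0 := by
        by_contra h
        exact hx (hmem x t ht' h)
      have e2 : φ x = 0 := by
        by_contra h
        exact hx (hmem x 0 (by simp) (by simpa [flow_zero hF] using h))
      rw [e1, norm_zero] at hle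
      rw [e2, sub_zero]
      exact hle
  · exact ((integrable_indicator_iff hKc.measurableSet).2
      (integrableOn_const hKc.measure_lt_top.ne)).restrict
  · filter_upwards [ae_restrict_mem hΩ.measurableSet] with x hx
    have ht : Tendsto (fun t : ℝ≥0 => -(t : ℝ)) (𝓝[>] 0) (𝓝 0) :=
      ((NNReal.continuous_coe.neg).tendsto' 0 0 (by simp)).mono_left nhdsWithin_le_nhds
    have hD : ∀ᶠ t : ℝ≥0 in 𝓝[>] 0, (x, -(t : ℝ)) ∈ stayDomain F Ω :=
      ht.eventually_mem ((isOpen_stayTimes hF hΩ x).mem_nhds ((mem_stayDomain_zero hF).2 hx))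
    have hlim := ((hφ.comp (continuous_flow_right hF x)).tendsto 0).comp ht
    simp only [Function.comp_def, flow_zero hF] at hlim
    have := (hlim.sub_const (φ x)).norm
    rw [sub_self, norm_zero] at this
    refine this.congr' ?_
    filter_upwards [hD] with t htD
    rw [transport_of_mem htD, indicator_of_mem (flow_mem_of_mem_stayDomain htD)]

lemma isC0Semigroup_transportSemigroup [IsFiniteMeasureOnCompacts μ] (hF : LipschitzWith κ F)
    (hμ : FlowInvariant F μ) (hΩ : IsOpen Ω) :
    IsC0Semigroup (transportSemigroup (μ := μ) hF hμ hΩ) where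
  map_zero := by
    ext1 f
    refine eq_of_zeroExt_ae_eq hΩ ((zeroExt_transportSemigroup hF hμ hΩ 0 f).trans
      (Eventually.of_forall fun x => ?_))
    rw [ContinuousLinearMap.id_apply, NNReal.coe_zero]
    by_cases hx : x ∈ Ω
    · rw [transport_of_mem (by simpa using (mem_stayDomain_zero hF).2 hx), neg_zero,
        flow_zero hF]
    · rw [transport_eq_zero_of_notMem hF _ _ hx, zeroExt, indicator_of_notMem hx]
  map_add s t := by
    ext1 f
    refine eq_of_zeroExt_ae_eq hΩ ((zeroExt_transportSemigroup hF hμ hΩ _ f).trans ?_)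
    refine EventuallyEq.trans ?_ (zeroExt_transportSemigroup hF hμ hΩ s
      (transportSemigroup hF hμ hΩ t f)).symm
    rw [NNReal.coe_add, ← transport_transport hF s.coe_nonneg t.coe_nonneg]
    exact (ae_transport_congr hF hμ (zeroExt_transportSemigroup hF hμ hΩ t f) s).symm
  tendsto_zero f := by
    rw [Metric.tendsto_nhds]
    intro ε hε
    -- Density of compactly supported continuous functions together with contractivity: two errors
    -- of size at most `ε/3`, and one below `ε/3` for small `t`.
    obtain ⟨φ, hφc, hφε, hφ, hφi⟩ :=
      (L1.integrable_coeFn f).exists_hasCompactSupport_integral_sub_le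
        (by linarith : (0 : ℝ) < ε / 3)
    set p : L1Space Ω μ := hφi.toL1 φ
    have hpφ : p =ᵐ[μ.restrict Ω] φ := hφi.coeFn_toL1
    have hfp : ‖f - p‖ ≤ ε / 3 := by
      refine le_trans (le_of_eq ?_) hφε
      rw [L1.norm_eq_integral_norm]
      refine integral_congr_ae ?_
      filter_upwards [Lp.coeFn_sub f p, hpφ] with x h1 h2
      rw [h1, Pi.sub_apply, h2]
    have hlim := (tendsto_transport_of_hasCompactSupport (μ := μ) hF hΩ hφ hφc).eventually_lt_const
      (by linarith : (0 : ℝ) < ε / 3)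
    filter_upwards [hlim] with t ht
    have hnorm : ‖transportSemigroup hF hμ hΩ t p - p‖
        = ∫ x in Ω, ‖transport F Ω t (Ω.indicator φ) x - φ x‖ ∂μ := by
      rw [L1.norm_eq_integral_norm]
      refine integral_congr_ae ?_
      filter_upwards [Lp.coeFn_sub (transportSemigroup hF hμ hΩ t p) p, hpφ,
        transportLinear_ae_eq hF hμ hΩ t p,
        ae_restrict_of_ae (ae_transport_congr (Ω := Ω) hF hμ (zeroExt_ae_eq hΩ hpφ) t)]
        with x h1 h2 h3 h4
      rw [h1, Pi.sub_apply, h2, ← h4, ← h3]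
      rfl
    have hcontr : ‖transportSemigroup hF hμ hΩ t (f - p)‖ ≤ ‖f - p‖ :=
      ((transportSemigroup hF hμ hΩ t).le_of_opNorm_le
        (norm_transportSemigroup_le hF hμ hΩ t) _).trans_eq (one_mul _)
    rw [dist_eq_norm]
    calc ‖transportSemigroup hF hμ hΩ t f - f‖
        = ‖transportSemigroup hF hμ hΩ t (f - p)
          + (transportSemigroup hF hμ hΩ t p - p) + (p - f)‖ := by
          rw [map_sub]; congr 1; abel
      _ ≤ ‖transportSemigroup hF hμ hΩ t (f - p)‖
          + ‖transportSemigroup hF hμ hΩ t p - p‖ + ‖p - f‖ := norm_add₃_le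
      _ < ε := by rw [norm_sub_rev p f]; linarith [hnorm ▸ ht]

/-! ### Orbit integrals computed pointwise -/

/-- Integration over a set, as a continuous linear functional on `L¹`. -/
def setIntegralCLM {α : Type*} [MeasurableSpace α] (ν : Measure α) (A : Set α) :
    Lp ℝ 1 ν →L[ℝ] ℝ :=
  LinearMap.mkContinuous
    { toFun := fun f => ∫ x in A, f x ∂ν
      map_add' := fun f g => by
        rw [← integral_add (L1.integrable_coeFn f).restrict (L1.integrable_coeFn g).restrict]
        exact integral_congr_ae (ae_restrict_of_ae (Lp.coeFn_add f g))
      map_smul' := fun c f => by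
        rw [RingHom.id_apply, ← integral_smul]
        exact integral_congr_ae (ae_restrict_of_ae (Lp.coeFn_smul c f)) } 1 fun f => by
    rw [one_mul, L1.norm_eq_integral_norm]
    exact (norm_integral_le_integral_norm _).trans (setIntegral_le_integral
      (L1.integrable_coeFn f).norm (Eventually.of_forall fun _ => norm_nonneg _))

lemma setIntegralCLM_apply {α : Type*} [MeasurableSpace α] (ν : Measure α) (A : Set α)
    (f : Lp ℝ 1 ν) : setIntegralCLM ν A f = ∫ x in A, f x ∂ν := rfl

/-- The Bochner integral in `L¹` of an orbit of the semigroup is computed pointwise. -/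
lemma integral_transportSemigroup_ae_eq [IsFiniteMeasureOnCompacts μ] (hF : LipschitzWith κ F)
    (hμ : FlowInvariant F μ) (hΩ : IsOpen Ω) (g : L1Space Ω μ) (t : ℝ≥0) :
    ((∫ s in (0 : ℝ)..t, transportSemigroup hF hμ hΩ s.toNNReal g : L1Space Ω μ) : Phase N → ℝ)
      =ᵐ[μ.restrict Ω] fun x => ∫ s in (0 : ℝ)..t, transport F Ω s (zeroExt Ω g) x := by
  have hprod : ∀ A, Integrable (fun p : Phase N × ℝ => transport F Ω p.2 (zeroExt Ω g) p.1)
      (((μ.restrict Ω).restrict A).prod (volume.restrict (Ioc 0 (t : ℝ)))) := fun A =>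
    (integrable_transport_prod hF hμ hΩ (stronglyMeasurable_zeroExt hΩ g)
      (integrable_zeroExt hΩ g) _).mono_measure
      (Measure.prod_mono (Measure.restrict_le_self.trans Measure.restrict_le_self) le_rfl)
  have hV : Integrable (fun x => ∫ s in (0 : ℝ)..t, transport F Ω s (zeroExt Ω g) x)
      (μ.restrict Ω) := by
    simp only [intervalIntegral.integral_of_le t.coe_nonneg]
    have := (hprod univ).integral_prod_left
    rwa [Measure.restrict_univ] at this
  -- The two functions are compared by integrating over measurable sets `A`: a continuous functional
  -- passes through the Bochner integral, and Fubini treats the pointwise one.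
  refine Integrable.ae_eq_of_forall_setIntegral_eq _ _ (L1.integrable_coeFn _) hV
    fun A _ _ => ?_
  have hcont := (isC0Semigroup_transportSemigroup (μ := μ) hF hμ hΩ).continuous_orbit_real
    (norm_transportSemigroup_le hF hμ hΩ) g
  rw [← setIntegralCLM_apply, ← ContinuousLinearMap.intervalIntegral_comp_comm _
    (hcont.intervalIntegrable _ _)]
  simp only [intervalIntegral.integral_of_le t.coe_nonneg]
  rw [integral_integral_swap (f := fun x s => transport F Ω s (zeroExt Ω g) x) (hprod A)]
  refine setIntegral_congr_fun measurableSet_Ioc fun s hs => ?_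
  simp only [setIntegralCLM_apply]
  refine integral_congr_ae (ae_restrict_of_ae ?_)
  have := transportLinear_ae_eq hF hμ hΩ (s.toNNReal : ℝ) g
  rw [Real.coe_toNNReal s hs.1.le] at this
  refine EventuallyEq.trans (Eventually.of_forall fun x => ?_) this
  change transportLinear hF hμ hΩ (s.toNNReal : ℝ) g x = _
  rw [Real.coe_toNNReal s hs.1.le]

lemma integral_transport_of_mem (h : Phase N → ℝ) {x : Phase N} {t : ℝ} (ht : 0 ≤ t)
    (hx : (x, -t) ∈ stayDomain F Ω) :
    ∫ s in (0 : ℝ)..t, transport F Ω s h x = -∫ s in (0 : ℝ)..(-t), h (flow F x s) := by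
  rw [intervalIntegral.integral_congr (g := fun s => h (flow F x (-s))),
    intervalIntegral.integral_comp_neg (fun s => h (flow F x s)), neg_zero,
    intervalIntegral.integral_symm]
  intro s hs
  refine transport_of_mem (stayDomain_mono hx ?_)
  rw [uIcc_of_le ht] at hs
  rw [uIcc_of_ge (by linarith)]
  exact ⟨by linarith [hs.2], by linarith [hs.1]⟩

lemma tauMinus_lt_top_of_notMem (hF : LipschitzWith κ F) (hΩ : IsOpen Ω) {x : Phase N}
    (hxΩ : x ∈ Ω) {t : ℝ} (ht : 0 ≤ t) (hx : (x, -t) ∉ stayDomain F Ω) :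
    tauMinus F Ω x < ∞ := by
  rw [← ofReal_lt_tauMinus_iff hF hΩ hxΩ ht, not_lt] at hx
  exact hx.trans_lt ENNReal.ofReal_lt_top

/-- The cut-off kills the integrand after time `τ₋(x) ≤ t`, so the integral stops at the entry
point. The single time `s = τ₋(x)`, where the cut-off already acts, is negligible. -/
lemma integral_transport_of_notMem (hF : LipschitzWith κ F) (hΩ : IsOpen Ω) {h : Phase N → ℝ}
    {x : Phase N} (hxΩ : x ∈ Ω)
    (hi : ∀ a b : ℝ, IntervalIntegrable (fun s => h (flow F x s)) volume a b) {t : ℝ}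
    (ht : 0 ≤ t) (hx : (x, -t) ∉ stayDomain F Ω) :
    ∫ s in (0 : ℝ)..t, transport F Ω s h x
      = -∫ s in (0 : ℝ)..(-(tauMinus F Ω x).toReal), h (flow F x s) := by
  have hτ := tauMinus_lt_top_of_notMem hF hΩ hxΩ ht hx
  set τ := (tauMinus F Ω x).toReal
  have hpos : 0 < τ := tauMinus_toReal_pos hF hΩ hxΩ hτ
  have hle : τ ≤ t := by
    by_contra hc
    exact hx ((lt_tauMinus_toReal_iff hF hΩ hxΩ hτ ht).1 (not_le.1 hc))
  have hneg : ∀ a b : ℝ, IntervalIntegrable (fun s => h (flow F x (-s))) volume a b :=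
    fun a b => by
      simpa using (IntervalIntegrable.iff_comp_neg (f := fun s => h (flow F x s))).1 (hi (-a) (-b))
  have e1 : ∀ᵐ s : ℝ, s ∈ uIoc 0 τ → h (flow F x (-s)) = transport F Ω s h x := by
    filter_upwards [compl_mem_ae_iff.2 (measure_singleton (μ := volume) τ)] with s hsτ hs
    rw [uIoc_of_le hpos.le] at hs
    exact (transport_of_mem ((lt_tauMinus_toReal_iff hF hΩ hxΩ hτ hs.1.le).1
      (lt_of_le_of_ne hs.2 hsτ))).symm
  have e2 : ∀ᵐ s : ℝ, s ∈ uIoc τ t → (0 : ℝ) = transport F Ω s h x :=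
    Eventually.of_forall fun s hs => by
      rw [uIoc_of_le hle] at hs
      refine (transport_of_notMem fun hD => ?_).symm
      exact absurd ((lt_tauMinus_toReal_iff hF hΩ hxΩ hτ (hpos.le.trans hs.1.le)).2 hD)
        (not_lt.2 hs.1.le)
  have i1 : IntervalIntegrable (fun s => transport F Ω s h x) volume 0 τ :=
    (hneg 0 τ).congr_ae ((ae_restrict_iff' measurableSet_uIoc).2 e1)
  have i2 : IntervalIntegrable (fun s => transport F Ω s h x) volume τ t :=
    (intervalIntegrable_const (c := (0 : ℝ))).congr_ae
      ((ae_restrict_iff' measurableSet_uIoc).2 e2)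
  rw [← intervalIntegral.integral_add_adjacent_intervals i1 i2,
    ← intervalIntegral.integral_congr_ae e1, ← intervalIntegral.integral_congr_ae e2,
    intervalIntegral.integral_comp_neg (fun s => h (flow F x s)), neg_zero,
    intervalIntegral.integral_symm]
  simp

/-! ### Identification of the generator -/

/-- The identity `U(t)f - f = ∫₀ᵗ U(s)g ds` is checked pointwise. Before the entry time it is the
integrated weak equation; after it, `U(t)f` vanishes and the identity expresses that the entry value
of `f` is zero. -/
lemma zeroInflowTransport_subset_generatorGraph [IsFiniteMeasureOnCompacts μ]
    (hF : LipschitzWith κ F) (hμ : FlowInvariant F μ) (hΩ : IsOpen Ω) :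
    zeroInflowTransport F Ω μ ⊆ generatorGraph (transportSemigroup (μ := μ) hF hμ hΩ) := by
  rintro ⟨f, g⟩ hfg
  refine (isC0Semigroup_transportSemigroup hF hμ hΩ).mem_generatorGraph
    (norm_transportSemigroup_le hF hμ hΩ) fun t => Lp.ext ?_
  refine EventuallyEq.trans ?_ (integral_transportSemigroup_ae_eq hF hμ hΩ g t).symm
  filter_upwards [Lp.coeFn_sub (transportSemigroup hF hμ hΩ t f) f,
    transportLinear_ae_eq hF hμ hΩ t f, ae_restrict_mem hΩ.measurableSet,
    ae_restrict_of_ae (ae_eq_sub_integral_of_maxTransport hF hμ hΩ hfg.1 (-(t : ℝ))),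
    ae_restrict_of_ae (ae_entry_value_eq_zero hF hμ hΩ hfg),
    ae_restrict_of_ae (ae_isRegularPoint hF hμ hΩ hfg.1)] with x h1 h2 hx h3 h4 h5
  rw [h1, Pi.sub_apply]
  change transportLinear hF hμ hΩ t f x - f x = _
  rw [h2, ← zeroExt_of_mem f hx]
  by_cases hD : (x, -(t : ℝ)) ∈ stayDomain F Ω
  · rw [integral_transport_of_mem _ t.coe_nonneg hD, transport_of_mem hD, h3 hD]
    ring
  · rw [integral_transport_of_notMem hF hΩ hx (h5 hx).intervalIntegrable t.coe_nonneg hD,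
      transport_of_notMem hD]
    linarith [h4 hx (tauMinus_lt_top_of_notMem hF hΩ hx t.coe_nonneg hD)]

lemma IsTestFunction.measurable_indicator (hΩ : IsOpen Ω) {ψ : Phase N → ℝ}
    (hψ : Measurable fun x : Ω => ψ x) : Measurable (Ω.indicator ψ) := by
  refine measurable_of_restrict_of_restrict_compl hΩ.measurableSet ?_ ?_
  · convert hψ using 1
    funext x
    exact indicator_of_mem x.2 _
  · convert (measurable_const : Measurable fun _ : (Ωᶜ : Set (Phase N)) => (0 : ℝ)) using 1
    funext x
    exact indicator_of_notMem x.2 _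

lemma zeroExt_mul_indicator (f : L1Space Ω μ) (ψ : Phase N → ℝ) (x : Phase N) :
    zeroExt Ω f x * ψ x = zeroExt Ω f x * Ω.indicator ψ x := by
  by_cases hx : x ∈ Ω
  · rw [indicator_of_mem hx]
  · rw [zeroExt, indicator_of_notMem hx, zero_mul, zero_mul]

lemma IsTestFunction.exists_norm_indicator_le {ψ : Phase N → ℝ}
    (h : ∃ C : ℝ, ∀ x ∈ Ω, |ψ x| ≤ C) : ∃ C : ℝ, 0 ≤ C ∧ ∀ x, ‖Ω.indicator ψ x‖ ≤ C := by
  obtain ⟨C, hC⟩ := h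
  refine ⟨max C 0, le_max_right _ _, fun x => ?_⟩
  by_cases hx : x ∈ Ω
  · rw [indicator_of_mem hx]
    exact (hC x hx).trans (le_max_left _ _)
  · rw [indicator_of_notMem hx, norm_zero]
    exact le_max_right _ _

lemma IsTestFunction.integrable_mul (hΩ : IsOpen Ω) {ψ : Phase N → ℝ}
    (hψ : IsTestFunction F Ω μ ψ) (f : L1Space Ω μ) :
    Integrable (fun x => zeroExt Ω f x * ψ x) μ := by
  obtain ⟨C, -, hC⟩ := exists_norm_indicator_le hψ.bounded
  simp only [zeroExt_mul_indicator f ψ]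
  exact (integrable_zeroExt hΩ f).mul_bdd
    (measurable_indicator hΩ hψ.measurable).aestronglyMeasurable (Eventually.of_forall hC)

/-- Along a characteristic, a test function has the derivative `charDeriv`. -/
lemma IsTestFunction.hasDerivAt_flow (hF : LipschitzWith κ F) (hΩ : IsOpen Ω) {ψ : Phase N → ℝ}
    (hψ : IsTestFunction F Ω μ ψ) {x : Phase N} {t : ℝ} (ht : (x, t) ∈ stayDomain F Ω) :
    HasDerivAt (fun s => ψ (flow F x s)) (charDeriv F ψ (flow F x t)) t := by
  have hI : stayInterval F Ω x = {t : ℝ | (x, t) ∈ stayDomain F Ω} :=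
    ext fun s => mem_stayInterval_iff hF hΩ (mem_of_mem_stayDomain hF ht)
  have hd : DifferentiableAt ℝ (fun s => ψ (flow F x s)) t := by
    refine ((hψ.contDiff_along x (mem_of_mem_stayDomain hF ht)).differentiableOn
      one_ne_zero).differentiableAt ?_
    rw [hI]
    exact (isOpen_stayTimes hF hΩ x).mem_nhds ht
  have : charDeriv F ψ (flow F x t) = deriv (fun s => ψ (flow F x s)) t := by
    simp only [charDeriv, flow_flow hF]
    rw [deriv_comp_const_add (f := fun s => ψ (flow F x s)), add_zero]
  rw [this]
  exact hd.hasDerivAt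

/-- The weak formulation holds for the generator of the transport semigroup. -/
lemma generatorGraph_subset_maxTransport [IsFiniteMeasureOnCompacts μ]
    (hF : LipschitzWith κ F) (hμ : FlowInvariant F μ) (hΩ : IsOpen Ω) :
    generatorGraph (transportSemigroup (μ := μ) hF hμ hΩ) ⊆ maxTransport F Ω μ := by
  rintro ⟨f, g⟩ hfg ψ hψ
  set ψ₀ := Ω.indicator ψ with hψ₀
  have hψm : Measurable ψ₀ := IsTestFunction.measurable_indicator hΩ hψ.measurable
  obtain ⟨C, -, hC⟩ := IsTestFunction.exists_norm_indicator_le hψ.bounded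
  obtain ⟨C', hC'0, hC'⟩ := IsTestFunction.exists_norm_indicator_le hψ.bounded_charDeriv
  obtain ⟨K, hK, hKΩ, hKψ⟩ := hψ.compact_support
  have hf := integrable_zeroExt hΩ f
  -- the pairing with `ψ` is a continuous linear functional
  let L : L1Space Ω μ →L[ℝ] ℝ := LinearMap.mkContinuous
    { toFun := fun p => ∫ x, zeroExt Ω p x * ψ₀ x ∂μ
      map_add' := fun p q => by
        have hi := fun p => hψ.integrable_mul hΩ p
        simp only [zeroExt_mul_indicator _ ψ] at hi
        rw [← integral_add (hi p) (hi q)]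
        refine integral_congr_ae ?_
        filter_upwards [zeroExt_add hΩ p q] with x hx
        rw [hx, add_mul]
      map_smul' := fun c p => by
        rw [RingHom.id_apply, ← integral_smul]
        refine integral_congr_ae ?_
        filter_upwards [zeroExt_smul hΩ c p] with x hx
        rw [hx, smul_mul_assoc] } C fun p => by
    rw [norm_eq_integral_zeroExt hΩ, mul_comm, ← integral_mul_const]
    refine norm_integral_le_of_norm_le ((integrable_zeroExt hΩ p).norm.mul_const C)
      (Eventually.of_forall fun x => ?_)
    rw [norm_mul]
    gcongr
    exact hC x
  have hL : ∀ p, L p = ∫ x, zeroExt Ω p x * ψ₀ x ∂μ := fun p => rfl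
  -- The substitution `y ↦ Φ(y,t)` moves the transport onto `ψ`: pairing the difference quotient of
  -- `f` with `ψ` equals integrating `f` against `q t`, a cut-off difference quotient of `ψ` in the
  -- forward direction.
  set q : ℝ≥0 → Phase N → ℝ := fun t y =>
    (t : ℝ)⁻¹ * ({y | (y, (t : ℝ)) ∈ stayDomain F Ω}.indicator (fun y => ψ₀ (flow F y t)) y
      - ψ₀ y) with hq
  have hDm : ∀ t : ℝ, MeasurableSet {y | (y, t) ∈ stayDomain F Ω} := fun t =>
    ((isOpen_stayDomain hF hΩ).preimage
      (by fun_prop : Continuous fun x : Phase N => (x, t))).measurableSet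
  have hindm : ∀ t : ℝ, Measurable
      ({y | (y, t) ∈ stayDomain F Ω}.indicator fun y => ψ₀ (flow F y t)) := fun t =>
    (hψm.comp (continuous_flow_left hF t).measurable).indicator (hDm t)
  have hindb : ∀ (t : ℝ) y,
      ‖{y | (y, t) ∈ stayDomain F Ω}.indicator (fun y => ψ₀ (flow F y t)) y‖ ≤ C :=
    fun t y => (norm_indicator_le_norm_self _ _).trans (hC _)
  have hLq : ∀ t : ℝ≥0, L ((t : ℝ)⁻¹ • (transportSemigroup hF hμ hΩ t f - f))
      = ∫ y, zeroExt Ω f y * q t y ∂μ := fun t => by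
    have h1 : L (transportSemigroup hF hμ hΩ t f) = ∫ y, zeroExt Ω f y *
        {y | (y, (t : ℝ)) ∈ stayDomain F Ω}.indicator (fun y => ψ₀ (flow F y t)) y ∂μ := by
      rw [hL, ← integral_comp_flow hF hμ _ (t : ℝ)]
      refine integral_congr_ae ?_
      filter_upwards [ae_comp_flow hF hμ (zeroExt_transportSemigroup hF hμ hΩ t f) t] with y hy
      rw [hy]
      by_cases hD : (y, (t : ℝ)) ∈ stayDomain F Ω
      · rw [transport_of_mem ((stayDomain_flow_symm hF).2 hD), flow_neg_flow hF,
          indicator_of_mem (by exact hD)]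
      · rw [transport_of_notMem (fun h => hD ((stayDomain_flow_symm hF).1 h)),
          indicator_of_notMem (by exact hD), zero_mul, mul_zero]
    have i1 : Integrable (fun y => zeroExt Ω f y *
        {y | (y, (t : ℝ)) ∈ stayDomain F Ω}.indicator (fun y => ψ₀ (flow F y t)) y) μ :=
      hf.mul_bdd (hindm t).aestronglyMeasurable (Eventually.of_forall (hindb t))
    have i2 : Integrable (fun y => zeroExt Ω f y * ψ₀ y) μ :=
      hf.mul_bdd hψm.aestronglyMeasurable (Eventually.of_forall hC)
    rw [map_smul, map_sub, h1, hL, ← integral_sub i1 i2, ← integral_smul]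
    congr 1
    funext y
    simp only [hq, smul_eq_mul]
    ring
  have hcoe : Tendsto (fun t : ℝ≥0 => (t : ℝ)) (𝓝[>] 0) (𝓝[≠] 0) := by
    refine tendsto_nhdsWithin_iff.2 ⟨?_, ?_⟩
    · exact (NNReal.continuous_coe.tendsto' 0 0 rfl).mono_left nhdsWithin_le_nhds
    · filter_upwards [self_mem_nhdsWithin] with t ht
      exact (NNReal.coe_pos.2 ht).ne'
  have hcoe' : Tendsto (fun t : ℝ≥0 => (t : ℝ)) (𝓝[>] 0) (𝓝 0) :=
    hcoe.mono_right nhdsWithin_le_nhds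
  -- By compactness of `K`, one time `t` is short enough for all points of `K` to stay in `Ω`. A
  -- point that leaves is therefore off `K`, where `ψ` vanishes almost everywhere; without this `q
  -- t` could be of size `1/t`.
  have hKt : ∀ᶠ t : ℝ≥0 in 𝓝[>] 0, ∀ y ∈ K, (y, (t : ℝ)) ∈ stayDomain F Ω := by
    refine hcoe'.eventually (hK.eventually_forall_of_forall_eventually
      (P := fun t y => (y, t) ∈ stayDomain F Ω) fun y hy => ?_)
    have hc : Continuous fun z : ℝ × Phase N => (z.2, z.1) := by fun_prop
    exact hc.continuousAt.eventually_mem ((isOpen_stayDomain hF hΩ).mem_nhds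
      ((mem_stayDomain_zero hF).2 (hKΩ hy)))
  have hlim1 : Tendsto (fun t : ℝ≥0 => ∫ y, zeroExt Ω f y * q t y ∂μ) (𝓝[>] 0) (𝓝 (L g)) := by
    have : Tendsto (fun t : ℝ≥0 => (t : ℝ)⁻¹ • (transportSemigroup hF hμ hΩ t f - f))
      (𝓝[>] 0) (𝓝 g) := hfg
    exact ((L.continuous.tendsto g).comp this).congr hLq
  have hlim2 : Tendsto (fun t : ℝ≥0 => ∫ y, zeroExt Ω f y * q t y ∂μ) (𝓝[>] 0)
      (𝓝 (∫ y, zeroExt Ω f y * charDeriv F ψ y ∂μ)) := by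
    refine tendsto_integral_filter_of_dominated_convergence (fun y => ‖zeroExt Ω f y‖ * C')
      (Eventually.of_forall fun t => ?_) ?_ (hf.norm.mul_const C') ?_
    · exact ((stronglyMeasurable_zeroExt hΩ f).mul
        (((hindm t).sub hψm).const_mul _).stronglyMeasurable).aestronglyMeasurable
    · filter_upwards [hKt, self_mem_nhdsWithin] with t ht ht0
      have ht0' : (0 : ℝ) < t := NNReal.coe_pos.2 ht0
      filter_upwards [(ae_restrict_iff' hΩ.measurableSet).1 hKψ] with y hy
      rw [norm_mul]
      by_cases hyΩ : y ∈ Ω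
      swap
      · rw [zeroExt, indicator_of_notMem hyΩ, norm_zero, zero_mul, zero_mul]
      refine mul_le_mul_of_nonneg_left ?_ (norm_nonneg _)
      by_cases hD : (y, (t : ℝ)) ∈ stayDomain F Ω
      · have hIcc : ∀ s ∈ Icc (0 : ℝ) t, (y, s) ∈ stayDomain F Ω := fun s hs =>
          stayDomain_mono hD (by rwa [uIcc_of_le ht0'.le])
        -- When the characteristic stays in `Ω`, the mean value inequality bounds `q t` by the bound
        -- `C'` on `Dψ`, uniformly in `t`.
        have hmv := Convex.norm_image_sub_le_of_norm_hasDerivWithin_le (𝕜 := ℝ) (C := C')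
          (f := fun s => ψ (flow F y s)) (f' := fun s => charDeriv F ψ (flow F y s))
          (s := Icc (0 : ℝ) t) (x := 0) (y := t)
          (fun s hs => (hψ.hasDerivAt_flow hF hΩ (hIcc s hs)).hasDerivWithinAt)
          (fun s hs => by
            have := hC' (flow F y s)
            rwa [indicator_of_mem (flow_mem_of_mem_stayDomain (hIcc s hs))] at this)
          (convex_Icc _ _) (left_mem_Icc.2 ht0'.le) (right_mem_Icc.2 ht0'.le)
        rw [flow_zero hF, sub_zero, Real.norm_of_nonneg ht0'.le] at hmv
        simp only [hq]
        rw [indicator_of_mem (by exact hD), hψ₀, indicator_of_mem (flow_mem_of_mem_stayDomain hD),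
          indicator_of_mem hyΩ, norm_mul, norm_inv, Real.norm_of_nonneg ht0'.le,
          inv_mul_le_iff₀ ht0']
        linarith
      · have hyK : y ∉ K := fun h => hD (ht y h)
        simp only [hq]
        rw [indicator_of_notMem (by exact hD), hψ₀, indicator_of_mem hyΩ, hy hyΩ hyK]
        simpa using hC'0
    · refine Eventually.of_forall fun y => ?_
      by_cases hyΩ : y ∈ Ω
      · refine Tendsto.const_mul _ ?_
        have hD : ∀ᶠ t : ℝ≥0 in 𝓝[>] 0, (y, (t : ℝ)) ∈ stayDomain F Ω :=
          hcoe'.eventually_mem ((isOpen_stayTimes hF hΩ y).mem_nhds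
            ((mem_stayDomain_zero hF).2 hyΩ))
        have hd := (hasDerivAt_iff_tendsto_slope_zero.1
          (hψ.hasDerivAt_flow hF hΩ ((mem_stayDomain_zero hF).2 hyΩ))).comp hcoe
        simp only [flow_zero hF, Function.comp_def, zero_add] at hd
        refine hd.congr' ?_
        filter_upwards [hD] with t htD
        simp only [hq]
        rw [indicator_of_mem (by exact htD), hψ₀,
          indicator_of_mem (flow_mem_of_mem_stayDomain htD), indicator_of_mem hyΩ, smul_eq_mul]
      · simp only [zeroExt, indicator_of_notMem hyΩ, zero_mul]
        exact tendsto_const_nhds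
  rw [setIntegral_mul_eq_zeroExt hΩ, setIntegral_mul_eq_zeroExt hΩ]
  simp only [zeroExt_mul_indicator g ψ]
  exact tendsto_nhds_unique hlim1 hlim2

/-- Once `t ≥ τ₋(x)` the identity `U(t)f - f = ∫₀ᵗ U(s)g ds` reads `-f(x) = ∫₀^τ g(Φ(x,-s)) ds` with
`τ = τ₋(x)`, so the entry value is zero. -/
lemma generatorGraph_subset_zeroInflowTransport [IsFiniteMeasureOnCompacts μ]
    (hF : LipschitzWith κ F) (hμ : FlowInvariant F μ) (hΩ : IsOpen Ω) :
    generatorGraph (transportSemigroup (μ := μ) hF hμ hΩ) ⊆ zeroInflowTransport F Ω μ := by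
  rintro ⟨f, g⟩ hfg
  have hmax := generatorGraph_subset_maxTransport hF hμ hΩ hfg
  refine ⟨hmax, isIncomingTrace_of_maxTransport hF hμ hΩ hmax ?_⟩
  -- Integer times suffice, because every finite `τ₋(x)` is exceeded by one of them; countably many
  -- times allow a common null set.
  have h : ∀ n : ℕ, ∀ᵐ x ∂μ, x ∈ Ω → transport F Ω n (zeroExt Ω f) x - zeroExt Ω f x
      = ∫ s in (0 : ℝ)..n, transport F Ω s (zeroExt Ω g) x := fun n => by
    rw [← ae_restrict_iff' hΩ.measurableSet]
    have h1 := (isC0Semigroup_transportSemigroup hF hμ hΩ).sub_eq_integral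
      (norm_transportSemigroup_le hF hμ hΩ) hfg n
    have h2 := integral_transportSemigroup_ae_eq hF hμ hΩ g n
    rw [← h1] at h2
    filter_upwards [h2, Lp.coeFn_sub (transportSemigroup hF hμ hΩ n f) f,
      transportLinear_ae_eq hF hμ hΩ ((n : ℝ≥0) : ℝ) f, zeroExt_ae_eq_self hΩ f]
      with x e1 e2 e3 e4
    rw [e2, Pi.sub_apply] at e1
    change transportLinear hF hμ hΩ ((n : ℝ≥0) : ℝ) f x - f x = _ at e1
    rw [e3, ← e4, NNReal.coe_natCast] at e1
    exact e1
  filter_upwards [ae_all_iff.2 h, ae_isRegularPoint hF hμ hΩ hmax] with x hx hreg hxΩ hτ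
  obtain ⟨n, hn⟩ := exists_nat_ge (tauMinus F Ω x).toReal
  have hD : (x, -(n : ℝ)) ∉ stayDomain F Ω := fun h =>
    absurd ((lt_tauMinus_toReal_iff hF hΩ hxΩ hτ n.cast_nonneg).2 h) (not_lt.2 hn)
  have := hx n hxΩ
  rw [integral_transport_of_notMem hF hΩ hxΩ (hreg hxΩ).intervalIntegrable n.cast_nonneg hD,
    transport_of_notMem hD] at this
  rw [Pi.zero_apply]
  linarith

/-! ### Single-valuedness of the maximal operator -/

lemma zeroExt_zero (hΩ : IsOpen Ω) : zeroExt Ω (0 : L1Space Ω μ) =ᵐ[μ] fun _ => (0 : ℝ) :=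
  (zeroExt_ae_eq hΩ (Lp.coeFn_zero ℝ 1 (μ.restrict Ω))).trans
    (Eventually.of_forall fun x => congrFun (indicator_zero' (M := ℝ)) x)

/-- The definition of the trace leaves `g` free, so `g = 0` and the zero representative serve. The
class `0` is zero only almost everywhere as a function, hence the passage to almost all times on
characteristics. -/
lemma isIncomingTrace_zero [IsFiniteMeasureOnCompacts μ] (hF : LipschitzWith κ F)
    (hμ : FlowInvariant F μ) (hΩ : IsOpen Ω) :
    IsIncomingTrace F Ω μ (0 : L1Space Ω μ) 0 := by
  have hz := (ae_restrict_iff' hΩ.measurableSet).1 (Lp.coeFn_zero ℝ 1 (μ.restrict Ω))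
  refine ⟨0, 0, ⟨Lp.coeFn_zero _ _ _, ?_⟩, Eventually.of_forall fun y _ => tendsto_const_nhds⟩
  filter_upwards [ae_restrict_of_ae (ae_ae_comp_flow hF hμ hz),
    ae_restrict_mem hΩ.measurableSet] with x hx hxΩ t₁ h₁ t₂ h₂ h12
  rw [mem_stayInterval_iff hF hΩ hxΩ] at h₁ h₂
  have h : ∀ᵐ s : ℝ, s ∈ uIoc t₁ t₂ → (0 : ℝ) = (0 : L1Space Ω μ) (flow F x s) := by
    filter_upwards [hx] with s hs hst
    exact (hs (flow_mem_of_mem_stayDomain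
      (mem_stayDomain_of_uIcc h₁ h₂ (uIoc_subset_uIcc hst)))).symm
  refine ⟨(intervalIntegrable_const (c := (0 : ℝ))).congr_ae
    ((ae_restrict_iff' measurableSet_uIoc).2 h), ?_⟩
  rw [← intervalIntegral.integral_congr_ae h]
  simp

/-- By linearity `(0, g₁ - g₂)` is in `T_max`. As the zero function has zero trace, the pair lies in
the generator graph, where `g₁ - g₂` is a limit of quotients that are all zero. -/
lemma maxTransport_single_valued [IsFiniteMeasureOnCompacts μ] (hF : LipschitzWith κ F)
    (hμ : FlowInvariant F μ) (hΩ : IsOpen Ω) {f g₁ g₂ : L1Space Ω μ}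
    (h₁ : (f, g₁) ∈ maxTransport F Ω μ) (h₂ : (f, g₂) ∈ maxTransport F Ω μ) : g₁ = g₂ := by
  have hmax : ((0 : L1Space Ω μ), g₁ - g₂) ∈ maxTransport F Ω μ := fun ψ hψ => by
    have e := (h₁ ψ hψ).trans (h₂ ψ hψ).symm
    simp only [setIntegral_mul_eq_zeroExt hΩ] at e ⊢
    have l : ∫ x, zeroExt Ω (g₁ - g₂) x * ψ x ∂μ
        = ∫ x, (zeroExt Ω g₁ x * ψ x - zeroExt Ω g₂ x * ψ x) ∂μ := by
      refine integral_congr_ae ?_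
      filter_upwards [zeroExt_sub hΩ g₁ g₂] with x hx
      rw [hx, sub_mul]
    have r : ∫ x, zeroExt Ω (0 : L1Space Ω μ) x * charDeriv F ψ x ∂μ = 0 := by
      refine integral_eq_zero_of_ae ?_
      filter_upwards [zeroExt_zero (μ := μ) hΩ] with x hx
      rw [hx, zero_mul]
      rfl
    rw [l, r, integral_sub (hψ.integrable_mul hΩ g₁) (hψ.integrable_mul hΩ g₂), e, sub_self]
  have hgen : Tendsto (fun t : ℝ≥0 => (t : ℝ)⁻¹ •
      (transportSemigroup hF hμ hΩ t (0 : L1Space Ω μ) - 0)) (𝓝[>] 0) (𝓝 (g₁ - g₂)) :=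
    zeroInflowTransport_subset_generatorGraph hF hμ hΩ
      ⟨hmax, isIncomingTrace_zero hF hμ hΩ⟩
  simp only [map_zero, sub_zero, smul_zero] at hgen
  exact sub_eq_zero.1 (tendsto_nhds_unique hgen tendsto_const_nhds)

end CharTransport

end

theorem mainTheorem2 (N : ℕ) (F : Phase N → Phase N) (κ : ℝ≥0)
    (hF : LipschitzWith κ F)
    (μ : Measure (Phase N)) [IsFiniteMeasureOnCompacts μ]
    (hμ : FlowInvariant F μ)
    (Ω : Set (Phase N)) (hΩ : IsOpen Ω) :
    -- `T_max` is single-valued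
    (∀ f g₁ g₂ : L1Space Ω μ,
      (f, g₁) ∈ maxTransport F Ω μ →
      (f, g₂) ∈ maxTransport F Ω μ → g₁ = g₂) ∧
    -- every element of the domain of `T_max` has an incoming trace, unique up to null sets
    (∀ f g : L1Space Ω μ, (f, g) ∈ maxTransport F Ω μ →
      ∃ b : Phase N → ℝ, IsIncomingTrace F Ω μ f b ∧
        ∀ b' : Phase N → ℝ, IsIncomingTrace F Ω μ f b' →
          ∀ᵐ y ∂(incomingMeasure F Ω μ),
            y ∈ incomingBoundary F Ω → b' y = b y) ∧
    -- `T₀` generates a nonnegative contraction semigroup, given by the explicit formula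
    ∃ U : ℝ≥0 → L1Space Ω μ →L[ℝ] L1Space Ω μ,
      IsC0Semigroup U ∧
      (∀ t : ℝ≥0, ‖U t‖ ≤ 1) ∧
      (∀ (t : ℝ≥0) (f : L1Space Ω μ), 0 ≤ f → 0 ≤ U t f) ∧
      (∀ (t : ℝ≥0) (f : L1Space Ω μ),
        ∀ᵐ x ∂(μ.restrict Ω), U t f x =
          {z | (t : ℝ≥0∞) < tauMinus F Ω z}.indicator (fun z => f (flow F z (-(t : ℝ)))) x) ∧
      generatorGraph U = zeroInflowTransport F Ω μ := by

  refine ⟨fun f g₁ g₂ h₁ h₂ => maxTransport_single_valued hF hμ hΩ h₁ h₂, fun f g hfg => ?_,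
    transportSemigroup hF hμ hΩ, isC0Semigroup_transportSemigroup hF hμ hΩ,
    norm_transportSemigroup_le hF hμ hΩ, fun t f hf => transportSemigroup_nonneg hF hμ hΩ t hf,
    transportSemigroup_apply_ae hF hμ hΩ,
    Subset.antisymm (generatorGraph_subset_zeroInflowTransport hF hμ hΩ)
      (zeroInflowTransport_subset_generatorGraph hF hμ hΩ)⟩
  obtain ⟨b, hb⟩ := exists_isIncomingTrace hF hμ hΩ hfg
  exact ⟨b, hb, fun b' hb' => hb.ae_eq hF hμ hΩ hb'⟩
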